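/- Consider one file that is stored at a source, a cache and a user. The file is updated at the source, update requests are sent by the cache to the source, and update requests are sent by the user to the cache, at the event times of three mutually independent Poisson processes (independent, exponentially distributed inter-event times) with rates $\lambda_i>0$, $c_i>0$ and $u_i>0$, respectively. All transmissions are instantaneous: at a request of the cache, the cache's copy is replaced by the current version at the source; at a request of the user, the user's copy is replaced by the version currently stored at the cache. At time $0$ the source, the cache and the user hold arbitrary fixed versions, the cache's version being no newer than the source's and the user's being no newer than the cache's. Let $f_u(i,1,t)=1$ if at time $t$ the user holds the current version of the source, and $f_u(i,1,t)=0$ otherwise. A request of the user is called a successful update if it replaces an outdated version at the user by the current version of the source. For $j\ge 1$, let $I_u(i,1,j)$ be the time between the $j$th and the $(j+1)$th successful updates ($j$th update cycle), and let $T_u(i,1,j)$ be the total time in this cycle during which the file at the user is fresh. Then almost surely there are infinitely many successful updates, $f_u(i,1,\cdot)$ is integrable on every bounded time interval $[0,T]$, and the long-term average freshness \[ F_u(i,1)=\lim_{T\to\infty}\frac1T\int_0^T f_u(i,1,t)\,dt \] exists. The $T_u(i,1,j)$, $j\ge1$, are identically distributed and so are the $I_u(i,1,j)$, $j\ge 1$;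 all have finite expectations, $\mathbb{E}[I_u(i,1)]>0$, and, almost surely, \[ F_u(i,1)=\frac{\mathbb{E}[T_u(i,1)]}{\mathbb{E}[I_u(i,1)]}=\frac{u_i}{u_i+\lambda_i}\cdot\frac{c_i}{c_i+\lambda_i}, \] where $T_u(i,1)$ and $I_u(i,1)$ denote typical $T_u(i,1,j)$ and $I_u(i,1,j)$. -/

import Mathlib

open MeasureTheory ProbabilityTheory Filter Topology

noncomputable section

namespace CacheUpdating

/-- The three places where events concerning one (cached) file happen: updates of the file at the
source, update requests by the cache to the source, update requests by the user to the cache. -/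
inductive Node : Type
  | source : Node
  | cache : Node
  | user : Node

/-- The rate of the events at each node. -/
def Node.rate (lam c u : ℝ) : Node → ℝ
  | Node.source => lam
  | Node.cache => c
  | Node.user => u

/-- `X s k` is the time between the `k`-th and the `(k+1)`-st event at the node `s` (for `k = 0`,
the time of the first event): all these times are independent, those at `s` are exponential with the
rate of `s`. So the events at the three nodes form three independent Poisson processes. -/
structure IsExponentialSystem {Ω : Type*} [MeasurableSpace Ω] (μ : Measure Ω) (lam c u : ℝ)
    (X : Node → ℕ → Ω → ℝ) : Prop where
  measurable : ∀ s k, Measurable (X s k)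
  law : ∀ s k, μ.map (X s k) = expMeasure (s.rate lam c u)
  indep : iIndepFun (fun p : Node × ℕ => X p.1 p.2) μ

/-- Time of the event number `k` (counted from `0`) of a stream with inter-event times `g`. -/
def eventTime (g : ℕ → ℝ) (k : ℕ) : ℝ := ∑ j ∈ Finset.range (k + 1), g j

/-- Number of events of a stream with inter-event times `g` up to and including time `t`. -/
def eventCount (g : ℕ → ℝ) (t : ℝ) : ℕ := {k : ℕ | eventTime g k ≤ t}.ncard

/-- The version held at time `t` by someone who holds the version `init` at time `0` and, at each
event time `r` of a stream with inter-event times `g`, replaces it by the version `v r`. -/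
def heldVersion (g : ℕ → ℝ) (init : ℤ) (v : ℝ → ℤ) (t : ℝ) : ℤ :=
  if eventCount g t = 0 then init else v (eventTime g (eventCount g t - 1))

/-- Version of the file at the source: `0` at time `0`, increased by one by every update. -/
def sourceVersion (x : Node → ℕ → ℝ) (t : ℝ) : ℤ := (eventCount (x Node.source) t : ℤ)

/-- Version of the file at the cache, which gets the version of the source at every request of the
cache, without delay; `a` is the version that the cache holds at time `0`. -/
def cacheVersion (x : Node → ℕ → ℝ) (a : ℤ) (t : ℝ) : ℤ :=
  heldVersion (x Node.cache) a (sourceVersion x) t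

/-- Version of the file at the user, who gets the version stored at the cache at every request of
the user, without delay; `b` is the version that the user holds at time `0`. -/
def userVersion (x : Node → ℕ → ℝ) (a b : ℤ) (t : ℝ) : ℤ :=
  heldVersion (x Node.user) b (cacheVersion x a) t

open Classical in
/-- Freshness function of the file at the user: `1` if the user holds the version that the source
has at time `t`, and `0` otherwise. -/
def freshness (x : Node → ℕ → ℝ) (a b : ℤ) (t : ℝ) : ℝ :=
  if userVersion x a b t = sourceVersion x t then 1 else 0

/-- Version held by the user just before the request number `m` (counted from `0`) of the user. -/
def versionBefore (x : Node → ℕ → ℝ) (a b : ℤ) (m : ℕ) : ℤ :=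
  if m = 0 then b else userVersion x a b (eventTime (x Node.user) (m - 1))

/-- The request number `m` of the user is a successful update: it replaces an outdated version of
the file by the freshest one. -/
def IsSuccessful (x : Node → ℕ → ℝ) (a b : ℤ) (m : ℕ) : Prop :=
  versionBefore x a b m ≠ sourceVersion x (eventTime (x Node.user) m) ∧
    userVersion x a b (eventTime (x Node.user) m) = sourceVersion x (eventTime (x Node.user) m)

/-- Time of the successful update number `j` (counted from `0`) at the user. -/
def successTime (x : Node → ℕ → ℝ) (a b : ℤ) (j : ℕ) : ℝ :=
  eventTime (x Node.user) (Nat.nth (IsSuccessful x a b) j)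

/-- Length of the update cycle number `j` (counted from `0`), the time between two consecutive
successful updates. -/
def cycleLength (x : Node → ℕ → ℝ) (a b : ℤ) (j : ℕ) : ℝ :=
  successTime x a b (j + 1) - successTime x a b j

/-- Total time during the update cycle number `j` at which the file at the user is fresh. -/
def freshDuration (x : Node → ℕ → ℝ) (a b : ℤ) (j : ℕ) : ℝ :=
  ∫ t in (successTime x a b j)..(successTime x a b (j + 1)), freshness x a b t

end CacheUpdating

end

/-!
The update process regenerates at the successful updates: at such a time the source, the cache and
the user hold the same version, and by the lack of memory of the exponential distribution the three
streams start afresh. So the update cycles are independent and identically distributed, and the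
strong law of large numbers turns the time average of the freshness into a quotient of expectations.

To make this precise, the three streams are merged. `next` sends a family of inter-event times to
the family met by an observer who starts at the first of all events. The central probabilistic fact
is `lintegral_step`: under the law of independent exponential times, `next x` again has this law and
is independent of the time and the node of the first event, the node being chosen with probabilities
proportional to the rates (`lintegral_firstNode`).

On the pathwise side, the versions of the cache and the user relative to the source follow the
recursion `advance` along `next`; in particular `freshness` and `IsSuccessful` do
(`freshness_add_wait`, `isSuccessful_next_of_ne`, `isSuccessful_succ_next`). What matters about
these versions is a `Status` with three values, and a successful update is a request of the user in
the status `cached`. Hence the times of the successful updates and the fresh times between them are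
sums along the orbit of `next` (`cycleLength_eq`, `freshDuration_eq`).

By induction on the number of steps, `lintegral_step` gives the independence of what precedes and
what follows a successful update (`lintegral_afterSuccess`). The expectations of a cycle solve the
linear equations of a first-step analysis (`expectedTime_eq`), which determine them once they are
known to be finite; finiteness comes from comparing truncated sums with an explicit solution
(`lintegral_partialReward_le`). Writing `σ`, `κ`, `υ` for the probabilities that the next event is
one of the source, the cache, the user, and `m` for the mean waiting time for the next event, the
mean fresh time is `m / σ` and the mean length is `m * (1 / σ + 1 / (κ * υ))`. As `σ + κ + υ = 1`,
their quotient is `κ * υ / ((κ + σ) * (υ + σ))`.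
-/

open scoped ENNReal

noncomputable section

namespace CacheUpdating

/-! ### A single stream of events -/

lemma eventTime_zero (g : ℕ → ℝ) : eventTime g 0 = g 0 := by simp [eventTime]

lemma eventTime_succ (g : ℕ → ℝ) (k : ℕ) :
    eventTime g (k + 1) = g 0 + eventTime (fun n => g (n + 1)) k := by
  rw [eventTime, Finset.sum_range_succ', add_comm, eventTime]

lemma eventTime_pos {g : ℕ → ℝ} (hg : ∀ k, 0 < g k) (k : ℕ) : 0 < eventTime g k :=
  Finset.sum_pos (fun j _ => hg j) (by simp)

lemma le_eventTime {g : ℕ → ℝ} (hg : ∀ k, 0 < g k) (k : ℕ) : g 0 ≤ eventTime g k :=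
  Finset.single_le_sum (f := g) (fun j _ => (hg j).le) (by simp)

lemma finite_eventTime_le {g : ℕ → ℝ} (h : Tendsto (eventTime g) atTop atTop) (t : ℝ) :
    {k | eventTime g k ≤ t}.Finite := by
  obtain ⟨N, hN⟩ := eventually_atTop.1 (h.eventually_gt_atTop t)
  refine (Set.finite_lt_nat N).subset fun k (hk : eventTime g k ≤ t) => ?_
  by_contra hkN
  exact absurd (hN k (not_lt.1 hkN)) (not_lt.2 hk)

lemma eventCount_of_lt {g : ℕ → ℝ} (hg : ∀ k, 0 < g k) {t : ℝ} (ht : t < g 0) :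
    eventCount g t = 0 := by
  have : {k | eventTime g k ≤ t} = ∅ := by
    ext k
    simpa using ht.trans_le (le_eventTime hg k)
  rw [eventCount, this, Set.ncard_empty]

lemma eventCount_mono {g : ℕ → ℝ} (h : Tendsto (eventTime g) atTop atTop) :
    Monotone (eventCount g) := fun _ t hst =>
  Set.ncard_le_ncard (fun _ hk => le_trans hk hst) (finite_eventTime_le h t)

lemma eventCount_add_first {g : ℕ → ℝ} (h : Tendsto (eventTime g) atTop atTop) {r : ℝ}
    (hr : 0 ≤ r) :
    eventCount g (g 0 + r) = eventCount (fun n => g (n + 1)) r + 1 := by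
  have hfin := finite_eventTime_le h (g 0 + r)
  have hset : {k | eventTime g k ≤ g 0 + r} =
      insert 0 (Nat.succ '' {k | eventTime (fun n => g (n + 1)) k ≤ r}) := by
    ext k
    cases k with
    | zero => simp [eventTime_zero, hr]
    | succ k => simp [eventTime_succ]
  have hfin' : (Nat.succ '' {k | eventTime (fun n => g (n + 1)) k ≤ r}).Finite :=
    hfin.subset (hset ▸ Set.subset_insert _ _)
  rw [eventCount, hset, Set.ncard_insert_of_notMem (by simp) hfin',
    Set.ncard_image_of_injective _ Nat.succ_injective, eventCount]

/-- The stream `g` seen from time `d` on, before its first event. -/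
def delayed (d : ℝ) (g : ℕ → ℝ) (k : ℕ) : ℝ := if k = 0 then g 0 - d else g k

lemma eventTime_delayed (d : ℝ) (g : ℕ → ℝ) (k : ℕ) :
    eventTime (delayed d g) k = eventTime g k - d := by
  rw [eventTime, eventTime, Finset.sum_range_succ', Finset.sum_range_succ']
  simp [delayed]
  ring

lemma eventCount_delayed (d : ℝ) (g : ℕ → ℝ) (r : ℝ) :
    eventCount g (d + r) = eventCount (delayed d g) r := by
  simp only [eventCount, eventTime_delayed, sub_le_iff_le_add']

lemma heldVersion_congr {g : ℕ → ℝ} {v v' : ℝ → ℤ} (h : ∀ k, v (eventTime g k) = v' (eventTime g k))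
    (init : ℤ) (t : ℝ) : heldVersion g init v t = heldVersion g init v' t := by
  simp only [heldVersion, h]

lemma heldVersion_add_const (g : ℕ → ℝ) (init : ℤ) (v : ℝ → ℤ) (d : ℤ) (t : ℝ) :
    heldVersion g (init + d) (fun r => v r + d) t = heldVersion g init v t + d := by
  simp only [heldVersion]
  split_ifs <;> rfl

lemma heldVersion_of_lt {g : ℕ → ℝ} (hg : ∀ k, 0 < g k) (init : ℤ) (v : ℝ → ℤ) {t : ℝ}
    (ht : t < g 0) : heldVersion g init v t = init := by
  simp [heldVersion, eventCount_of_lt hg ht]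

lemma heldVersion_delayed (d : ℝ) (g : ℕ → ℝ) (init : ℤ) (v : ℝ → ℤ) (r : ℝ) :
    heldVersion g init v (d + r) = heldVersion (delayed d g) init (fun q => v (d + q)) r := by
  simp only [heldVersion, eventCount_delayed, eventTime_delayed, add_sub_cancel]

/-- From the first event on, the version obtained there plays the role of the initial one. -/
lemma heldVersion_add_first {g : ℕ → ℝ} (h : Tendsto (eventTime g) atTop atTop)
    (init : ℤ) (v : ℝ → ℤ) {r : ℝ} (hr : 0 ≤ r) :
    heldVersion g init v (g 0 + r) =
      heldVersion (fun n => g (n + 1)) (v (g 0)) (fun q => v (g 0 + q)) r := by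
  simp only [heldVersion, eventCount_add_first h hr]
  rcases Nat.eq_zero_or_eq_succ_pred (eventCount (fun n => g (n + 1)) r) with h0 | h0
  · simp [h0, eventTime_zero]
  · rw [h0]
    simp [eventTime_succ]

lemma measurable_heldVersion {g : ℕ → ℝ} (h : Tendsto (eventTime g) atTop atTop)
    (init : ℤ) (v : ℝ → ℤ) : Measurable (heldVersion g init v) :=
  (measurable_from_nat (f := fun k : ℕ => if k = 0 then init else v (eventTime g (k - 1)))).comp
    (eventCount_mono h).measurable

/-! ### The merged stream -/

instance : DecidableEq Node := fun i j => by
  cases i <;> cases j <;> first | exact isTrue rfl | exact isFalse (by intro h; cases h)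

instance : Fintype Node := ⟨{Node.source, Node.cache, Node.user}, fun i => by cases i <;> simp⟩

instance : MeasurableSpace Node := ⊤

instance : DiscreteMeasurableSpace Node := ⟨fun _ => trivial⟩

/-- The inter-event times at all nodes, as one family of real numbers. -/
abbrev Gaps : Type := Node × ℕ → ℝ

/-- The first of all events takes place at the node `i`, and only there. -/
def IsFirst (i : Node) (x : Gaps) : Prop := ∀ j, j ≠ i → x (i, 0) < x (j, 0)

open Classical in
/-- The node of the first of all events (the value in case of ties is irrelevant). -/
def firstNode (x : Gaps) : Node :=
  if IsFirst Node.source x then Node.source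
  else if IsFirst Node.cache x then Node.cache else Node.user

/-- The time of the first of all events. -/
def wait (x : Gaps) : ℝ := x (firstNode x, 0)

/-- The inter-event times seen by an observer who starts at the first event of the node `i`, before
which nothing else has happened. -/
def residual (i : Node) (x : Gaps) : Gaps := fun p =>
  if p.1 = i then x (i, p.2 + 1) else if p.2 = 0 then x p - x (i, 0) else x p

/-- The inter-event times seen by an observer who starts at the first of all events. -/
def next (x : Gaps) : Gaps := residual (firstNode x) x

/-- Positive inter-event times without explosion, such that the first of all events is unique. -/
structure IsRegular (x : Gaps) : Prop where
  pos : ∀ p, 0 < x p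
  first : ∃ i, IsFirst i x
  tendsto : ∀ s, Tendsto (eventTime (Function.curry x s)) atTop atTop

lemma IsFirst.unique {i j : Node} {x : Gaps} (hi : IsFirst i x) (hj : IsFirst j x) : i = j := by
  by_contra h
  exact lt_asymm (hi j (Ne.symm h)) (hj i h)

lemma IsFirst.firstNode_eq {i : Node} {x : Gaps} (h : IsFirst i x) : firstNode x = i := by
  unfold firstNode
  split_ifs with h1 h2
  · exact h1.unique h
  · exact h2.unique h
  · cases i
    · exact absurd h h1
    · exact absurd h h2
    · rfl

lemma IsRegular.isFirst {x : Gaps} (hx : IsRegular x) : IsFirst (firstNode x) x := by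
  obtain ⟨i, hi⟩ := hx.first
  rwa [hi.firstNode_eq]

lemma IsRegular.wait_pos {x : Gaps} (hx : IsRegular x) : 0 < wait x := hx.pos _

lemma curry_next_self (x : Gaps) :
    Function.curry (next x) (firstNode x) = fun n => Function.curry x (firstNode x) (n + 1) := by
  funext k
  simp [Function.curry, next, residual]

lemma curry_next_of_ne {s : Node} {x : Gaps} (hs : s ≠ firstNode x) :
    Function.curry (next x) s = delayed (wait x) (Function.curry x s) := by
  funext k
  simp only [Function.curry, next, residual, hs, if_false, delayed, wait]
  split_ifs with h
  · rw [h]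
  · rfl

lemma wait_eq (x : Gaps) : wait x = Function.curry x (firstNode x) 0 := rfl

lemma IsRegular.lt_of_ne {x : Gaps} (hx : IsRegular x) {s : Node} (hs : s ≠ firstNode x) :
    wait x < Function.curry x s 0 := hx.isFirst s hs

lemma IsRegular.wait_le {x : Gaps} (hx : IsRegular x) (s : Node) :
    wait x ≤ Function.curry x s 0 := by
  by_cases hs : s = firstNode x
  · rw [hs, wait_eq]
  · exact (hx.lt_of_ne hs).le

lemma eventTime_next_of_ne {s : Node} {x : Gaps} (hs : s ≠ firstNode x) (k : ℕ) :
    eventTime (Function.curry x s) k = wait x + eventTime (Function.curry (next x) s) k := by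
  rw [curry_next_of_ne hs, eventTime_delayed]
  ring

lemma eventTime_next_self (x : Gaps) (k : ℕ) :
    eventTime (Function.curry x (firstNode x)) (k + 1) =
      wait x + eventTime (Function.curry (next x) (firstNode x)) k := by
  rw [curry_next_self, eventTime_succ, wait_eq]

lemma IsRegular.next_pos {x : Gaps} (hx : IsRegular x) (p : Node × ℕ) : 0 < next x p := by
  obtain ⟨s, k⟩ := p
  change 0 < Function.curry (next x) s k
  by_cases hs : s = firstNode x
  · subst hs
    rw [curry_next_self]
    exact hx.pos _
  · rw [curry_next_of_ne hs, delayed]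
    split_ifs
    · exact sub_pos.2 (hx.lt_of_ne hs)
    · exact hx.pos _

lemma heldVersion_add_wait_self {x : Gaps} (hx : IsRegular x) (init : ℤ) (v : ℝ → ℤ) {r : ℝ}
    (hr : 0 ≤ r) :
    heldVersion (Function.curry x (firstNode x)) init v (wait x + r) =
      heldVersion (Function.curry (next x) (firstNode x)) (v (wait x)) (fun q => v (wait x + q))
        r := by
  rw [curry_next_self]
  exact heldVersion_add_first (hx.tendsto _) init v hr

lemma heldVersion_add_wait_of_ne {s : Node} {x : Gaps} (hs : s ≠ firstNode x) (init : ℤ)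
    (v : ℝ → ℤ) (r : ℝ) :
    heldVersion (Function.curry x s) init v (wait x + r) =
      heldVersion (Function.curry (next x) s) init (fun q => v (wait x + q)) r := by
  rw [heldVersion_delayed, curry_next_of_ne hs]

/-! ### The versions seen from the first event on -/

/-- The versions of the cache and the user, relative to the one of the source, after an event at the
given node. -/
def advance : Node → ℤ × ℤ → ℤ × ℤ
  | Node.source, v => (v.1 - 1, v.2 - 1)
  | Node.cache, v => (0, v.2)
  | Node.user, v => (v.1, v.1)

/-- The increase of the version of the source caused by an event at the given node. -/
def increment (i : Node) : ℤ := if i = Node.source then 1 else 0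

lemma sourceVersion_of_lt {x : Gaps} (hx : IsRegular x) {t : ℝ} (ht : t < wait x) :
    sourceVersion (Function.curry x) t = 0 := by
  simp [sourceVersion,
    eventCount_of_lt (g := Function.curry x _) (fun _ => hx.pos _) (ht.trans_le (hx.wait_le _))]

lemma sourceVersion_zero {x : Gaps} (hx : ∀ p, 0 < x p) :
    sourceVersion (Function.curry x) 0 = 0 := by
  simp [sourceVersion, eventCount_of_lt (g := Function.curry x _) (fun _ => hx _) (hx _)]

lemma cacheVersion_zero {x : Gaps} (hx : ∀ p, 0 < x p) (a : ℤ) :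
    cacheVersion (Function.curry x) a 0 = a :=
  heldVersion_of_lt (fun _ => hx _) _ _ (hx _)

lemma userVersion_zero {x : Gaps} (hx : ∀ p, 0 < x p) (a b : ℤ) :
    userVersion (Function.curry x) a b 0 = b :=
  heldVersion_of_lt (fun _ => hx _) _ _ (hx _)

lemma sourceVersion_add_wait {x : Gaps} (hx : IsRegular x) {r : ℝ} (hr : 0 ≤ r) :
    sourceVersion (Function.curry x) (wait x + r) =
      sourceVersion (Function.curry (next x)) r + increment (firstNode x) := by
  unfold sourceVersion increment
  by_cases hs : firstNode x = Node.source
  · rw [if_pos hs, ← hs, curry_next_self, wait_eq, eventCount_add_first (hx.tendsto _) hr]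
    simp
  · rw [if_neg hs, eventCount_delayed, curry_next_of_ne (Ne.symm hs)]
    simp

lemma cacheVersion_add_wait {x : Gaps} (hx : IsRegular x) (v : ℤ × ℤ) {r : ℝ} (hr : 0 ≤ r) :
    cacheVersion (Function.curry x) v.1 (wait x + r) =
      cacheVersion (Function.curry (next x)) (advance (firstNode x) v).1 r +
        increment (firstNode x) := by
  have hsrc : ∀ k, sourceVersion (Function.curry x)
      (wait x + eventTime (Function.curry (next x) Node.cache) k) =
      sourceVersion (Function.curry (next x)) (eventTime (Function.curry (next x) Node.cache) k) +
        increment (firstNode x) := fun k =>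
    sourceVersion_add_wait hx (eventTime_pos (fun _ => hx.next_pos _) k).le
  unfold cacheVersion
  by_cases hs : firstNode x = Node.cache
  · have h0 : sourceVersion (Function.curry x) (wait x) = 0 := by
      have := sourceVersion_add_wait hx le_rfl
      rwa [add_zero, sourceVersion_zero hx.next_pos, hs] at this
    have key := heldVersion_add_wait_self hx v.1 (sourceVersion (Function.curry x)) hr
    rw [hs] at key
    rw [key, heldVersion_congr (v' := fun q => sourceVersion (Function.curry (next x)) q +
      increment (firstNode x)) hsrc, ← heldVersion_add_const, h0, hs]
    rfl
  · rw [heldVersion_add_wait_of_ne (Ne.symm hs), heldVersion_congr (v' := fun q =>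
      sourceVersion (Function.curry (next x)) q + increment (firstNode x)) hsrc,
      ← heldVersion_add_const]
    congr 1
    cases h : firstNode x <;> simp_all [advance, increment]

lemma userVersion_add_wait {x : Gaps} (hx : IsRegular x) (v : ℤ × ℤ) {r : ℝ} (hr : 0 ≤ r) :
    userVersion (Function.curry x) v.1 v.2 (wait x + r) =
      userVersion (Function.curry (next x)) (advance (firstNode x) v).1
        (advance (firstNode x) v).2 r + increment (firstNode x) := by
  have hsrc : ∀ k, cacheVersion (Function.curry x) v.1
      (wait x + eventTime (Function.curry (next x) Node.user) k) =
      cacheVersion (Function.curry (next x)) (advance (firstNode x) v).1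
        (eventTime (Function.curry (next x) Node.user) k) + increment (firstNode x) := fun k =>
    cacheVersion_add_wait hx v (eventTime_pos (fun _ => hx.next_pos _) k).le
  unfold userVersion
  by_cases hs : firstNode x = Node.user
  · have h0 : cacheVersion (Function.curry x) v.1 (wait x) = v.1 := by
      have := cacheVersion_add_wait hx v le_rfl
      rw [add_zero, cacheVersion_zero hx.next_pos, hs] at this
      simpa [advance, increment] using this
    have key := heldVersion_add_wait_self hx v.2 (cacheVersion (Function.curry x) v.1) hr
    rw [hs] at key
    rw [key, heldVersion_congr (v' := fun q => cacheVersion (Function.curry (next x))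
      (advance (firstNode x) v).1 q + increment (firstNode x)) hsrc, ← heldVersion_add_const, h0,
      hs]
    simp [advance, increment]
  · rw [heldVersion_add_wait_of_ne (Ne.symm hs), heldVersion_congr (v' := fun q =>
      cacheVersion (Function.curry (next x)) (advance (firstNode x) v).1 q +
        increment (firstNode x)) hsrc, ← heldVersion_add_const]
    congr 1
    cases h : firstNode x <;> simp_all [advance, increment]

lemma freshness_add_wait {x : Gaps} (hx : IsRegular x) (v : ℤ × ℤ) {r : ℝ} (hr : 0 ≤ r) :
    freshness (Function.curry x) v.1 v.2 (wait x + r) =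
      freshness (Function.curry (next x)) (advance (firstNode x) v).1
        (advance (firstNode x) v).2 r := by
  simp only [freshness, userVersion_add_wait hx v hr, sourceVersion_add_wait hx hr, add_left_inj]

lemma freshness_of_lt {x : Gaps} (hx : IsRegular x) (a b : ℤ) {t : ℝ} (ht : t < wait x) :
    freshness (Function.curry x) a b t = if b = 0 then 1 else 0 := by
  have : userVersion (Function.curry x) a b t = b :=
    heldVersion_of_lt (fun _ => hx.pos _) _ _ (ht.trans_le (hx.wait_le _))
  simp only [freshness, this, sourceVersion_of_lt hx ht]

lemma measurable_freshness {x : Gaps} (hx : IsRegular x) (a b : ℤ) :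
    Measurable (freshness (Function.curry x) a b) :=
  Measurable.ite (measurableSet_eq_fun (measurable_heldVersion (hx.tendsto _) _ _)
    (measurable_from_nat.comp (eventCount_mono (hx.tendsto _)).measurable)) measurable_const
    measurable_const

lemma freshness_nonneg (x : Node → ℕ → ℝ) (a b : ℤ) (t : ℝ) : 0 ≤ freshness x a b t := by
  unfold freshness
  split_ifs <;> norm_num

lemma freshness_le_one (x : Node → ℕ → ℝ) (a b : ℤ) (t : ℝ) : freshness x a b t ≤ 1 := by
  unfold freshness
  split_ifs <;> norm_num

lemma intervalIntegrable_freshness {x : Gaps} (hx : IsRegular x) (a b : ℤ) (p q : ℝ) :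
    IntervalIntegrable (freshness (Function.curry x) a b) volume p q :=
  (intervalIntegrable_const (c := (1 : ℝ))).mono_fun
    (measurable_freshness hx a b).aestronglyMeasurable
    (ae_of_all _ fun t => by
      simpa [abs_of_nonneg (freshness_nonneg _ a b t)] using freshness_le_one _ a b t)

/-- An event which is not a request of the user leaves the numbering of these requests
unchanged, and it has the same effect on the version before a request as on the versions after
it. -/
lemma isSuccessful_next_of_ne {x : Gaps} (hx : IsRegular x) (v : ℤ × ℤ)
    (h : firstNode x ≠ Node.user) (m : ℕ) :
    IsSuccessful (Function.curry x) v.1 v.2 m ↔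
      IsSuccessful (Function.curry (next x)) (advance (firstNode x) v).1
        (advance (firstNode x) v).2 m := by
  have hpos : ∀ k, 0 ≤ eventTime (Function.curry (next x) Node.user) k := fun k =>
    (eventTime_pos (fun _ => hx.next_pos _) k).le
  have hb : versionBefore (Function.curry x) v.1 v.2 m =
      versionBefore (Function.curry (next x)) (advance (firstNode x) v).1
        (advance (firstNode x) v).2 m + increment (firstNode x) := by
    unfold versionBefore
    split_ifs
    · cases h' : firstNode x <;> simp_all [advance, increment]
    · rw [eventTime_next_of_ne (Ne.symm h), userVersion_add_wait hx v (hpos _)]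
  rw [IsSuccessful, IsSuccessful, hb, eventTime_next_of_ne (Ne.symm h),
    userVersion_add_wait hx v (hpos _), sourceVersion_add_wait hx (hpos _)]
  simp

lemma isSuccessful_succ_next {x : Gaps} (hx : IsRegular x) (v : ℤ × ℤ)
    (h : firstNode x = Node.user) (m : ℕ) :
    IsSuccessful (Function.curry x) v.1 v.2 (m + 1) ↔
      IsSuccessful (Function.curry (next x)) (advance (firstNode x) v).1
        (advance (firstNode x) v).2 m := by
  have hpos : ∀ k, 0 ≤ eventTime (Function.curry (next x) Node.user) k := fun k =>
    (eventTime_pos (fun _ => hx.next_pos _) k).le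
  have het : ∀ k, eventTime (Function.curry x Node.user) (k + 1) =
      wait x + eventTime (Function.curry (next x) Node.user) k := by
    rw [← h]
    exact eventTime_next_self x
  have hb : versionBefore (Function.curry x) v.1 v.2 (m + 1) =
      versionBefore (Function.curry (next x)) (advance (firstNode x) v).1
        (advance (firstNode x) v).2 m + increment (firstNode x) := by
    unfold versionBefore
    cases m with
    -- what precedes the request `0` of the later observer is the first of all events
    | zero =>
      have h0 : eventTime (Function.curry x Node.user) 0 = wait x + 0 := by
        rw [eventTime_zero, wait_eq, h, add_zero]
      rw [if_neg (by simp), if_pos rfl, Nat.add_sub_cancel, h0, userVersion_add_wait hx v le_rfl,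
        userVersion_zero hx.next_pos]
    | succ m => simp [het, userVersion_add_wait hx v (hpos _)]
  rw [IsSuccessful, IsSuccessful, hb, het, userVersion_add_wait hx v (hpos _),
    sourceVersion_add_wait hx (hpos _)]
  simp

lemma isSuccessful_zero_iff {x : Gaps} (hx : IsRegular x) (v : ℤ × ℤ)
    (h : firstNode x = Node.user) :
    IsSuccessful (Function.curry x) v.1 v.2 0 ↔ v.2 ≠ 0 ∧ v.1 = 0 := by
  have h0 : eventTime (Function.curry x Node.user) 0 = wait x + 0 := by
    rw [eventTime_zero, wait_eq, h, add_zero]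
  rw [IsSuccessful, h0, userVersion_add_wait hx v le_rfl, sourceVersion_add_wait hx le_rfl,
    userVersion_zero hx.next_pos, sourceVersion_zero hx.next_pos, h]
  simp [versionBefore, advance, increment]

/-! ### Freshness status and the first success -/

/-- What matters about the stored versions: neither the cache nor the user, only the cache, or both
hold the current version of the source. -/
inductive Status : Type
  | stale : Status
  | cached : Status
  | fresh : Status
  deriving DecidableEq

instance : Fintype Status :=
  ⟨{Status.stale, Status.cached, Status.fresh}, fun s => by cases s <;> simp⟩

/-- The status after an event at the given node. -/
def Status.step : Status → Node → Status
  | _, Node.source => Status.stale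
  | Status.fresh, _ => Status.fresh
  | Status.cached, Node.cache => Status.cached
  | Status.cached, Node.user => Status.fresh
  | Status.stale, Node.cache => Status.cached
  | Status.stale, Node.user => Status.stale

/-- The status when the cache and the user hold the versions `v.1` and `v.2` and the source holds
the version `0`. It is meaningful only for `v.2 ≤ v.1 ≤ 0`. -/
def status (v : ℤ × ℤ) : Status :=
  if v.2 = 0 then Status.fresh else if v.1 = 0 then Status.cached else Status.stale

lemma status_advance {v : ℤ × ℤ} (h₁ : v.2 ≤ v.1) (h₂ : v.1 ≤ 0) (i : Node) :
    status (advance i v) = (status v).step i := by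
  obtain ⟨a, b⟩ := v
  simp only at h₁ h₂
  cases i <;> simp only [status, advance]
  · have hb : b - 1 ≠ 0 := by lia
    have ha : a - 1 ≠ 0 := by lia
    simp [ha, hb, Status.step]
  · by_cases hb : b = 0
    · simp [hb, Status.step]
    · by_cases ha : a = 0 <;> simp [ha, hb, Status.step]
  · by_cases hb : b = 0
    · simp [hb, show a = 0 by lia, Status.step]
    · by_cases ha : a = 0 <;> simp [ha, hb, Status.step]

lemma advance_le {v : ℤ × ℤ} (h₁ : v.2 ≤ v.1) (h₂ : v.1 ≤ 0) (i : Node) :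
    (advance i v).2 ≤ (advance i v).1 ∧ (advance i v).1 ≤ 0 := by
  cases i <;> simp only [advance] <;> lia

/-- An event at the node `i` is a successful update if the status before it is `s`. -/
def Succeeds (s : Status) (i : Node) : Prop := s = Status.cached ∧ i = Node.user

instance (s : Status) (i : Node) : Decidable (Succeeds s i) :=
  inferInstanceAs (Decidable (_ ∧ _))

lemma succeeds_status_iff {v : ℤ × ℤ} (i : Node) :
    Succeeds (status v) i ↔ (v.2 ≠ 0 ∧ v.1 = 0) ∧ i = Node.user := by
  unfold Succeeds status
  by_cases h₁ : v.2 = 0 <;> by_cases h₂ : v.1 = 0 <;> simp [h₁, h₂]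

/-- The event number `n` of the merged stream is a successful update, `s` being the status at
time `0`. -/
def Hit : ℕ → Status → Gaps → Prop
  | 0, s, x => Succeeds s (firstNode x)
  | n + 1, s, x => Hit n (s.step (firstNode x)) (next x)

/-- The inter-event times seen by an observer who starts at the first successful update (of no
meaning if there is none). -/
def afterSuccess (s : Status) (x : Gaps) : Gaps := next^[sInf {n | Hit n s x} + 1] x

lemma afterSuccess_of_succeeds {s : Status} {x : Gaps} (h : Succeeds s (firstNode x)) :
    afterSuccess s x = next x := by
  have : sInf {n | Hit n s x} = 0 := Nat.sInf_eq_zero.2 (Or.inl h)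
  simp [afterSuccess, this]

lemma afterSuccess_of_not_succeeds {s : Status} {x : Gaps} (h : ¬ Succeeds s (firstNode x))
    (hit : ∃ n, Hit n (s.step (firstNode x)) (next x)) :
    afterSuccess s x = afterSuccess (s.step (firstNode x)) (next x) := by
  have hne : {n | Hit n (s.step (firstNode x)) (next x)}.Nonempty := hit
  have hne' : {n | Hit n s x}.Nonempty := by
    obtain ⟨n, hn⟩ := hit
    exact ⟨n + 1, hn⟩
  have : sInf {n | Hit n s x} = sInf {n | Hit n (s.step (firstNode x)) (next x)} + 1 := by
    apply le_antisymm
    · exact Nat.sInf_le (Nat.sInf_mem hne)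
    · have hmem := Nat.sInf_mem hne'
      rcases hk : sInf {n | Hit n s x} with _ | k
      · rw [hk] at hmem
        exact absurd hmem h
      · rw [hk] at hmem
        exact Nat.succ_le_succ (Nat.sInf_le hmem)
  rw [afterSuccess, this, Function.iterate_succ_apply, afterSuccess]

/-- The sum of `r sₖ * w xₖ` over the first `n` merged events, or up to the first successful update
if this is earlier, where `sₖ` is the status and `xₖ` the family of inter-event times that an
observer meets after `k` events. -/
def partialReward (r : Status → ℝ≥0∞) (w : Gaps → ℝ≥0∞) : ℕ → Status → Gaps → ℝ≥0∞
  | 0, _, _ => 0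
  | n + 1, s, x => r s * w x +
      if Succeeds s (firstNode x) then 0
      else partialReward r w n (s.step (firstNode x)) (next x)

/-- The sum of `r sₖ * w xₖ` over all merged events up to the first successful update. -/
def reward (r : Status → ℝ≥0∞) (w : Gaps → ℝ≥0∞) (s : Status) (x : Gaps) : ℝ≥0∞ :=
  ⨆ n, partialReward r w n s x

lemma partialReward_succ (r : Status → ℝ≥0∞) (w : Gaps → ℝ≥0∞) (n : ℕ) (s : Status) (x : Gaps) :
    partialReward r w (n + 1) s x = r s * w x +
      if Succeeds s (firstNode x) then 0
      else partialReward r w n (s.step (firstNode x)) (next x) := rfl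

lemma partialReward_mono (r : Status → ℝ≥0∞) (w : Gaps → ℝ≥0∞) (s : Status) (x : Gaps) :
    Monotone fun n => partialReward r w n s x := by
  refine monotone_nat_of_le_succ fun n => ?_
  induction n generalizing s x with
  | zero => exact zero_le
  | succ n ih =>
    rw [partialReward_succ r w (n + 1), partialReward_succ r w n]
    refine add_le_add le_rfl ?_
    split_ifs
    · exact le_rfl
    · exact ih _ _

lemma reward_eq (r : Status → ℝ≥0∞) (w : Gaps → ℝ≥0∞) (s : Status) (x : Gaps) :
    reward r w s x = r s * w x +
      if Succeeds s (firstNode x) then 0 else reward r w (s.step (firstNode x)) (next x) := by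
  rw [reward, ← (partialReward_mono r w s x).iSup_nat_add 1]
  simp only [partialReward]
  rw [← ENNReal.add_iSup]
  split_ifs <;> simp [reward]

/-- The weight of the statuses with which `timeToSuccess` is the whole time. -/
def always : Status → ℝ≥0∞ := fun _ => 1

/-- The weight of the statuses with which `timeToSuccess` is the time with a fresh file at the
user. -/
def onlyFresh (s : Status) : ℝ≥0∞ := if s = Status.fresh then 1 else 0

/-- The time before the first successful update, weighted by the status: all of it for
`r = always`, the part with a fresh file at the user for `r = onlyFresh`. -/
def timeToSuccess (r : Status → ℝ≥0∞) (s : Status) (x : Gaps) : ℝ≥0∞ :=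
  reward r (fun y => ENNReal.ofReal (wait y)) s x

/-- The family of inter-event times remains regular for ever, and a successful update comes from
whichever status. -/
def IsGood (x : Gaps) : Prop :=
  ∀ n, IsRegular (next^[n] x) ∧ ∀ s, ∃ k, Hit k s (next^[n] x)

lemma IsGood.iterate_next {x : Gaps} (hx : IsGood x) (n : ℕ) : IsGood (next^[n] x) := fun m => by
  rw [← Function.iterate_add_apply]
  exact hx _

lemma IsGood.next {x : Gaps} (hx : IsGood x) : IsGood (next x) := hx.iterate_next 1

lemma IsGood.isRegular {x : Gaps} (hx : IsGood x) : IsRegular x := (hx 0).1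

lemma IsGood.exists_hit {x : Gaps} (hx : IsGood x) (s : Status) : ∃ k, Hit k s x := (hx 0).2 s

lemma IsGood.afterSuccess {x : Gaps} (hx : IsGood x) (s : Status) : IsGood (afterSuccess s x) :=
  hx.iterate_next _

/-- The first successful update is the request number `m` of the user and takes place at time `L`.
Up to then the file at the user is fresh during a total time `D`, and `y` is the family of
inter-event times that an observer meets from then on, when all hold the current version. -/
structure IsFirstSuccess (x y : Gaps) (v : ℤ × ℤ) (m : ℕ) (L D : ℝ) : Prop where
  nonneg : 0 ≤ L
  success : IsSuccessful (Function.curry x) v.1 v.2 m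
  not_before : ∀ k < m, ¬ IsSuccessful (Function.curry x) v.1 v.2 k
  success_iff : ∀ k, IsSuccessful (Function.curry x) v.1 v.2 (m + 1 + k) ↔
    IsSuccessful (Function.curry y) 0 0 k
  eventTime : eventTime (Function.curry x Node.user) m = L
  eventTime_add : ∀ k, CacheUpdating.eventTime (Function.curry x Node.user) (m + 1 + k) =
    L + CacheUpdating.eventTime (Function.curry y Node.user) k
  freshness_add : ∀ t, 0 ≤ t →
    freshness (Function.curry x) v.1 v.2 (L + t) = freshness (Function.curry y) 0 0 t
  integral : ∫ t in (0 : ℝ)..L, freshness (Function.curry x) v.1 v.2 t = D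

lemma integral_freshness_add_wait {x : Gaps} (hx : IsRegular x) (v : ℤ × ℤ) {L : ℝ} (hL : 0 ≤ L) :
    ∫ t in (0 : ℝ)..(wait x + L), freshness (Function.curry x) v.1 v.2 t =
      (if v.2 = 0 then wait x else 0) +
        ∫ t in (0 : ℝ)..L, freshness (Function.curry (next x)) (advance (firstNode x) v).1
          (advance (firstNode x) v).2 t := by
  have hw := hx.wait_pos
  rw [← intervalIntegral.integral_add_adjacent_intervals (b := wait x)
    (intervalIntegrable_freshness hx _ _ _ _) (intervalIntegrable_freshness hx _ _ _ _)]
  congr 1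
  · have : ∫ t in (0 : ℝ)..(wait x), freshness (Function.curry x) v.1 v.2 t =
        ∫ t in (0 : ℝ)..(wait x), if v.2 = 0 then (1 : ℝ) else 0 := by
      refine intervalIntegral.integral_congr_ae ?_
      filter_upwards [(Set.countable_singleton (wait x)).ae_notMem volume] with t ht htm
      rw [Set.uIoc_of_le hw.le] at htm
      exact freshness_of_lt hx _ _ (lt_of_le_of_ne htm.2 ht)
    rw [this]
    simp
  · have := intervalIntegral.integral_comp_add_left (a := 0) (b := L)
      (freshness (Function.curry x) v.1 v.2) (wait x)
    rw [add_zero] at this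
    rw [← this]
    refine intervalIntegral.integral_congr fun t ht => ?_
    rw [Set.uIcc_of_le hL] at ht
    exact freshness_add_wait hx v ht.1

lemma onlyFresh_mul_ofReal (v : ℤ × ℤ) (t : ℝ) :
    onlyFresh (status v) * ENNReal.ofReal t = ENNReal.ofReal (if v.2 = 0 then t else 0) := by
  unfold onlyFresh status
  by_cases h₁ : v.2 = 0 <;> by_cases h₂ : v.1 = 0 <;> simp [h₁, h₂]

lemma isFirstSuccess_of_succeeds {x : Gaps} (hx : IsRegular x) {v : ℤ × ℤ}
    (h : Succeeds (status v) (firstNode x)) : IsFirstSuccess x (next x) v 0 (wait x) 0 := by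
  obtain ⟨⟨hb, ha⟩, hi⟩ := (succeeds_status_iff _).1 h
  have hadv : advance (firstNode x) v = (0, 0) := by rw [hi]; simp [advance, ha]
  refine ⟨hx.wait_pos.le, (isSuccessful_zero_iff hx v hi).2 ⟨hb, ha⟩, by simp, fun k => ?_, ?_,
    fun k => ?_, fun t ht => ?_, ?_⟩
  · rw [zero_add, add_comm, isSuccessful_succ_next hx v hi, hadv]
  · rw [eventTime_zero, wait_eq, hi]
  · have := eventTime_next_self x k
    rwa [hi, ← add_comm 1, ← zero_add 1] at this
  · rw [freshness_add_wait hx v ht, hadv]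
  · have := integral_freshness_add_wait hx v le_rfl
    rw [add_zero, if_neg hb] at this
    simpa using this

lemma IsFirstSuccess.of_next {x y : Gaps} (hx : IsRegular x) {v : ℤ × ℤ} {m : ℕ} {L D : ℝ}
    (h : ¬ Succeeds (status v) (firstNode x))
    (H : IsFirstSuccess (next x) y (advance (firstNode x) v) m L D) :
    IsFirstSuccess x y v (if firstNode x = Node.user then m + 1 else m) (wait x + L)
      ((if v.2 = 0 then wait x else 0) + D) := by
  have hfresh : ∀ t, 0 ≤ t → freshness (Function.curry x) v.1 v.2 (wait x + L + t) =
      freshness (Function.curry y) 0 0 t := fun t ht => by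
    rw [add_assoc, freshness_add_wait hx v (add_nonneg H.nonneg ht), H.freshness_add t ht]
  have hint := integral_freshness_add_wait hx v H.nonneg
  rw [H.integral] at hint
  by_cases hi : firstNode x = Node.user
  · rw [if_pos hi]
    refine ⟨add_nonneg hx.wait_pos.le H.nonneg, (isSuccessful_succ_next hx v hi m).2 H.success,
      fun k hk => ?_, fun k => ?_, ?_, fun k => ?_, hfresh, hint⟩
    · cases k with
      | zero =>
        rw [isSuccessful_zero_iff hx v hi]
        exact fun h' => h ((succeeds_status_iff _).2 ⟨h', hi⟩)
      | succ k =>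
        rw [isSuccessful_succ_next hx v hi]
        exact H.not_before k (by lia)
    · rw [show m + 1 + 1 + k = m + 1 + k + 1 by ring, isSuccessful_succ_next hx v hi,
        H.success_iff]
    · have := eventTime_next_self x m
      rwa [hi, H.eventTime] at this
    · have := eventTime_next_self x (m + 1 + k)
      rw [hi, H.eventTime_add] at this
      rw [show m + 1 + 1 + k = m + 1 + k + 1 by ring, this, add_assoc]
  · rw [if_neg hi]
    refine ⟨add_nonneg hx.wait_pos.le H.nonneg, (isSuccessful_next_of_ne hx v hi m).2 H.success,
      fun k hk => ?_, fun k => ?_, ?_, fun k => ?_, hfresh, hint⟩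
    · rw [isSuccessful_next_of_ne hx v hi]
      exact H.not_before k hk
    · rw [isSuccessful_next_of_ne hx v hi, H.success_iff]
    · rw [eventTime_next_of_ne (Ne.symm hi), H.eventTime]
    · rw [eventTime_next_of_ne (Ne.symm hi), H.eventTime_add, add_assoc]

/-- The pathwise description of the first successful update in terms of the merged stream, by
induction on the number of a merged event which is a successful update. -/
lemma exists_isFirstSuccess {x : Gaps} (hx : IsGood x) {v : ℤ × ℤ} (h₁ : v.2 ≤ v.1)
    (h₂ : v.1 ≤ 0) :
    ∃ (m : ℕ) (L D : ℝ), 0 ≤ D ∧ IsFirstSuccess x (afterSuccess (status v) x) v m L D ∧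
      timeToSuccess always (status v) x = ENNReal.ofReal L ∧
      timeToSuccess onlyFresh (status v) x = ENNReal.ofReal D := by
  obtain ⟨n, hn⟩ := hx.exists_hit (status v)
  induction n generalizing x v with
  | zero =>
    have hn' : Succeeds (status v) (firstNode x) := hn
    have H := isFirstSuccess_of_succeeds hx.isRegular hn'
    rw [← afterSuccess_of_succeeds hn'] at H
    refine ⟨_, _, _, le_rfl, H, ?_, ?_⟩
    · rw [timeToSuccess, reward_eq, if_pos hn']
      simp [always]
    · rw [timeToSuccess, reward_eq, if_pos hn', onlyFresh_mul_ofReal,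
        if_neg ((succeeds_status_iff _).1 hn').1.1]
      simp
  | succ n ih =>
    by_cases hs : Succeeds (status v) (firstNode x)
    · have H := isFirstSuccess_of_succeeds hx.isRegular hs
      rw [← afterSuccess_of_succeeds hs] at H
      refine ⟨_, _, _, le_rfl, H, ?_, ?_⟩
      · rw [timeToSuccess, reward_eq, if_pos hs]
        simp [always]
      · rw [timeToSuccess, reward_eq, if_pos hs, onlyFresh_mul_ofReal,
          if_neg ((succeeds_status_iff _).1 hs).1.1]
        simp
    · obtain ⟨h₁', h₂'⟩ := advance_le h₁ h₂ (firstNode x)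
      have hst := status_advance h₁ h₂ (firstNode x)
      obtain ⟨m, L, D, hD, H, hL', hD'⟩ := ih hx.next h₁' h₂' (by rw [hst]; exact hn)
      have H' := H.of_next hx.isRegular hs
      rw [hst] at hL' hD' H'
      rw [← afterSuccess_of_not_succeeds hs (hx.next.exists_hit _)] at H'
      have hw := hx.isRegular.wait_pos.le
      refine ⟨_, _, _, ?_, H', ?_, ?_⟩
      · split_ifs <;> positivity
      · rw [timeToSuccess, reward_eq, if_neg hs, ← timeToSuccess, hL',
          ENNReal.ofReal_add hw H.nonneg, always, one_mul]
      · rw [timeToSuccess, reward_eq, if_neg hs, ← timeToSuccess, hD', onlyFresh_mul_ofReal,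
          ENNReal.ofReal_add (by split_ifs <;> simp [hw]) hD]

/-! ### Cycles -/

lemma nth_zero_of_first {p : ℕ → Prop} {m : ℕ} (hm : p m) (hlt : ∀ k < m, ¬ p k) :
    Nat.nth p 0 = m := by
  classical
  have : Nat.count p m = 0 := by
    rw [Nat.count_eq_card_filter_range, Finset.card_eq_zero, Finset.filter_eq_empty_iff]
    exact fun k hk => hlt k (Finset.mem_range.1 hk)
  rw [← this]
  exact Nat.nth_count hm

lemma nth_succ_of_first {p q : ℕ → Prop} {m : ℕ} (hm : p m) (hlt : ∀ k < m, ¬ p k)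
    (hpq : ∀ k, p (m + 1 + k) ↔ q k) (hq : {k | q k}.Infinite) (j : ℕ) :
    Nat.nth p (j + 1) = m + 1 + Nat.nth q j := by
  classical
  have h0 : Nat.count p m = 0 := by
    rw [Nat.count_eq_card_filter_range, Finset.card_eq_zero, Finset.filter_eq_empty_iff]
    exact fun k hk => hlt k (Finset.mem_range.1 hk)
  have hc : Nat.count p (m + 1 + Nat.nth q j) = j + 1 := by
    rw [Nat.count_add, Nat.count_succ, h0, if_pos hm]
    simp only [hpq]
    rw [Nat.count_nth_of_infinite hq]
    ring
  rw [← hc]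
  exact Nat.nth_count ((hpq _).2 (Nat.nth_mem_of_infinite hq j))

lemma status_zero : status (0, 0) = Status.fresh := by simp [status]

/-- Each successful update is followed by another one, because the streams seen from it on are
good. -/
lemma infinite_isSuccessful {x : Gaps} (hx : IsGood x) {a b : ℤ} (hba : b ≤ a) (ha : a ≤ 0) :
    {m | IsSuccessful (Function.curry x) a b m}.Infinite := by
  refine Set.infinite_of_forall_exists_gt fun n => ?_
  induction n using Nat.strong_induction_on generalizing x a b with
  | _ n ih =>
    obtain ⟨m, L, D, -, H, -, -⟩ := exists_isFirstSuccess hx (v := (a, b)) hba ha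
    by_cases hmn : n < m
    · exact ⟨m, H.success, hmn⟩
    · rcases Nat.eq_or_lt_of_le (not_lt.1 hmn) with h | h
      · obtain ⟨m', L', D', -, H', -, -⟩ :=
          exists_isFirstSuccess (hx.afterSuccess (status (a, b))) (v := (0, 0)) le_rfl le_rfl
        exact ⟨m + 1 + m', (H.success_iff _).2 H'.success, by lia⟩
      · obtain ⟨k, hk, hkn⟩ := ih (n - m - 1) (by lia) (hx.afterSuccess (status (a, b)))
          le_rfl le_rfl
        exact ⟨m + 1 + k, (H.success_iff _).2 hk, by lia⟩

/-- The passage from one successful update to the next: it leaves all places with the current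
version, which is the status `fresh`. -/
def nextCycle : Gaps → Gaps := afterSuccess Status.fresh

/-- The length of the cycle that starts at time `0` (for `r = always`), and the time during which
the file at the user is fresh in it (for `r = onlyFresh`). -/
def cycleTime (r : Status → ℝ≥0∞) (x : Gaps) : ℝ := (timeToSuccess r Status.fresh x).toReal

section

variable {x : Gaps} {a b : ℤ}

lemma successTime_zero (hx : IsGood x) (hba : b ≤ a) (ha : a ≤ 0) :
    successTime (Function.curry x) a b 0 = (timeToSuccess always (status (a, b)) x).toReal := by
  obtain ⟨m, L, D, -, H, hL, -⟩ := exists_isFirstSuccess hx (v := (a, b)) hba ha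
  rw [successTime, nth_zero_of_first H.success H.not_before, H.eventTime, hL,
    ENNReal.toReal_ofReal H.nonneg]

lemma integral_freshness_successTime_zero (hx : IsGood x) (hba : b ≤ a) (ha : a ≤ 0) :
    ∫ t in (0 : ℝ)..(successTime (Function.curry x) a b 0), freshness (Function.curry x) a b t =
      (timeToSuccess onlyFresh (status (a, b)) x).toReal := by
  obtain ⟨m, L, D, hD, H, hL, hD'⟩ := exists_isFirstSuccess hx (v := (a, b)) hba ha
  rw [successTime, nth_zero_of_first H.success H.not_before, H.eventTime, hD',
    ENNReal.toReal_ofReal hD]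
  exact H.integral

lemma successTime_succ (hx : IsGood x) (hba : b ≤ a) (ha : a ≤ 0) (j : ℕ) :
    successTime (Function.curry x) a b (j + 1) = successTime (Function.curry x) a b 0 +
      successTime (Function.curry (afterSuccess (status (a, b)) x)) 0 0 j := by
  obtain ⟨m, L, D, -, H, -, -⟩ := exists_isFirstSuccess hx (v := (a, b)) hba ha
  rw [successTime, successTime, successTime, nth_zero_of_first H.success H.not_before,
    nth_succ_of_first H.success H.not_before H.success_iff
      (infinite_isSuccessful (hx.afterSuccess _) le_rfl le_rfl),
    H.eventTime, H.eventTime_add]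

lemma freshness_successTime_zero_add (hx : IsGood x) (hba : b ≤ a) (ha : a ≤ 0) {t : ℝ}
    (ht : 0 ≤ t) :
    freshness (Function.curry x) a b (successTime (Function.curry x) a b 0 + t) =
      freshness (Function.curry (afterSuccess (status (a, b)) x)) 0 0 t := by
  obtain ⟨m, L, D, -, H, -, -⟩ := exists_isFirstSuccess hx (v := (a, b)) hba ha
  rw [successTime, nth_zero_of_first H.success H.not_before, H.eventTime]
  exact H.freshness_add t ht

lemma successTime_nonneg (hx : IsGood x) (a b : ℤ) (j : ℕ) :
    0 ≤ successTime (Function.curry x) a b j :=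
  (eventTime_pos (fun _ => hx.isRegular.pos _) _).le

lemma cycleLength_succ (hx : IsGood x) (hba : b ≤ a) (ha : a ≤ 0) (j : ℕ) :
    cycleLength (Function.curry x) a b (j + 1) =
      cycleLength (Function.curry (afterSuccess (status (a, b)) x)) 0 0 j := by
  rw [cycleLength, cycleLength, successTime_succ hx hba ha, successTime_succ hx hba ha]
  ring

lemma integral_freshness_successTime_zero_add (hx : IsGood x) (hba : b ≤ a) (ha : a ≤ 0) {p q : ℝ}
    (hp : 0 ≤ p) (hq : 0 ≤ q) :
    ∫ t in (successTime (Function.curry x) a b 0 + p)..(successTime (Function.curry x) a b 0 + q),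
      freshness (Function.curry x) a b t =
    ∫ t in p..q, freshness (Function.curry (afterSuccess (status (a, b)) x)) 0 0 t := by
  rw [← intervalIntegral.integral_comp_add_left (freshness (Function.curry x) a b)]
  refine intervalIntegral.integral_congr fun t ht => ?_
  exact freshness_successTime_zero_add hx hba ha ((le_min hp hq).trans ht.1)

lemma freshDuration_succ (hx : IsGood x) (hba : b ≤ a) (ha : a ≤ 0) (j : ℕ) :
    freshDuration (Function.curry x) a b (j + 1) =
      freshDuration (Function.curry (afterSuccess (status (a, b)) x)) 0 0 j := by
  rw [freshDuration, freshDuration, successTime_succ hx hba ha, successTime_succ hx hba ha]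
  exact integral_freshness_successTime_zero_add hx hba ha
    (successTime_nonneg (hx.afterSuccess _) _ _ _) (successTime_nonneg (hx.afterSuccess _) _ _ _)

lemma cycleLength_eq (hx : IsGood x) (hba : b ≤ a) (ha : a ≤ 0) (j : ℕ) :
    cycleLength (Function.curry x) a b j =
      cycleTime always (nextCycle^[j] (afterSuccess (status (a, b)) x)) := by
  induction j generalizing x a b with
  | zero =>
    rw [cycleLength, successTime_succ hx hba ha, add_sub_cancel_left,
      successTime_zero (hx.afterSuccess _) le_rfl le_rfl, status_zero]
    rfl
  | succ j ih =>
    rw [cycleLength_succ hx hba ha, ih (hx.afterSuccess _) le_rfl le_rfl, status_zero]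
    rfl

lemma freshDuration_eq (hx : IsGood x) (hba : b ≤ a) (ha : a ≤ 0) (j : ℕ) :
    freshDuration (Function.curry x) a b j =
      cycleTime onlyFresh (nextCycle^[j] (afterSuccess (status (a, b)) x)) := by
  induction j generalizing x a b with
  | zero =>
    have h := integral_freshness_successTime_zero_add hx hba ha le_rfl
      (successTime_nonneg (hx.afterSuccess (status (a, b))) 0 0 0)
    rw [add_zero] at h
    rw [freshDuration, successTime_succ hx hba ha, h,
      integral_freshness_successTime_zero (hx.afterSuccess _) le_rfl le_rfl, status_zero]
    rfl
  | succ j ih =>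
    rw [freshDuration_succ hx hba ha, ih (hx.afterSuccess _) le_rfl le_rfl, status_zero]
    rfl

end

/-! ### Exponential distributions and product measures -/

lemma lintegral_expMeasure {r : ℝ} {f : ℝ → ℝ≥0∞} (hf : Measurable f) :
    ∫⁻ t, f t ∂(expMeasure r) = ∫⁻ t, exponentialPDF r t * f t :=
  lintegral_withDensity_eq_lintegral_mul _ (measurable_exponentialPDFReal r).ennreal_ofReal hf

lemma expMeasure_absolutelyContinuous (r : ℝ) : expMeasure r ≪ volume :=
  withDensity_absolutelyContinuous _ _

lemma ae_pos_expMeasure (r : ℝ) : ∀ᵐ t ∂(expMeasure r), 0 < t := by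
  have h : ∀ᵐ t ∂(expMeasure r), t ≠ 0 :=
    (expMeasure_absolutelyContinuous r).ae_le ((Set.countable_singleton (0 : ℝ)).ae_notMem volume)
  have h' : ∀ᵐ t ∂(expMeasure r), 0 ≤ t := by
    refine (ae_withDensity_iff (measurable_exponentialPDFReal r).ennreal_ofReal).2
      (ae_of_all _ fun t ht => ?_)
    by_contra hneg
    exact ht (exponentialPDF_of_neg (not_le.1 hneg))
  filter_upwards [h, h'] with t h1 h2 using lt_of_le_of_ne h2 (Ne.symm h1)

lemma lintegral_ofReal_expMeasure {r : ℝ} (hr : 0 < r) :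
    ∫⁻ t, ENNReal.ofReal t ∂(expMeasure r) = ENNReal.ofReal (1 / r) := by
  rw [lintegral_expMeasure ENNReal.measurable_ofReal]
  have : ∀ t, exponentialPDF r t * ENNReal.ofReal t = ENNReal.ofReal (1 / r) * gammaPDF 2 r t := by
    intro t
    rcases lt_or_ge t 0 with ht | ht
    · rw [exponentialPDF_of_neg ht, gammaPDF_of_neg ht, zero_mul, mul_zero]
    · rw [exponentialPDF_of_nonneg ht, gammaPDF_of_nonneg ht, ← ENNReal.ofReal_mul (by positivity),
        ← ENNReal.ofReal_mul (by positivity)]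
      congr 1
      have h2 : Real.Gamma 2 = 1 := Real.Gamma_two
      have h1 : t ^ ((2 : ℝ) - 1) = t := by norm_num
      rw [h2, h1, Real.rpow_two]
      field_simp
  simp_rw [this]
  rw [lintegral_const_mul' _ _ ENNReal.ofReal_ne_top, lintegral_gammaPDF_eq_one two_pos hr, mul_one]

/-- The exponential distribution is memoryless. -/
lemma lintegral_expMeasure_sub {r d : ℝ} (hd : 0 ≤ d) {f : ℝ → ℝ≥0∞}
    (hf : Measurable f) :
    ∫⁻ t, (if d < t then f (t - d) else 0) ∂(expMeasure r) =
      ENNReal.ofReal (Real.exp (-(r * d))) * ∫⁻ t, f t ∂(expMeasure r) := by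
  have hm : Measurable fun t : ℝ => if d < t then f (t - d) else 0 :=
    Measurable.ite measurableSet_Ioi (by fun_prop) measurable_const
  rw [lintegral_expMeasure hm, lintegral_expMeasure hf,
    ← lintegral_const_mul' _ _ ENNReal.ofReal_ne_top,
    ← lintegral_add_right_eq_self (fun t => exponentialPDF r t * if d < t then f (t - d) else 0) d]
  refine lintegral_congr_ae ?_
  filter_upwards [(Set.countable_singleton (0 : ℝ)).ae_notMem volume] with t ht
  rcases lt_or_gt_of_ne (show t ≠ 0 from ht) with ht | ht
  · simp [exponentialPDF_of_neg ht, not_lt.2 ht.le]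
  · rw [exponentialPDF_of_nonneg ht.le,
      exponentialPDF_of_nonneg (add_pos_of_pos_of_nonneg ht hd).le, if_pos (by linarith), add_sub_cancel_right,
      ← mul_assoc, ← ENNReal.ofReal_mul (by positivity)]
    congr 2
    rw [mul_left_comm, ← Real.exp_add]
    ring_nf

lemma lintegral_exp_neg_mul_expMeasure {r q : ℝ} (hr : 0 < r) (hq : 0 ≤ q) :
    ∫⁻ t, ENNReal.ofReal (Real.exp (-(q * t))) ∂(expMeasure r) = ENNReal.ofReal (r / (r + q)) := by
  rw [lintegral_expMeasure (by fun_prop)]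
  have : ∀ t, exponentialPDF r t * ENNReal.ofReal (Real.exp (-(q * t))) =
      ENNReal.ofReal (r / (r + q)) * exponentialPDF (r + q) t := by
    intro t
    rcases lt_or_ge t 0 with ht | ht
    · rw [exponentialPDF_of_neg ht, exponentialPDF_of_neg ht, zero_mul, mul_zero]
    · rw [exponentialPDF_of_nonneg ht, exponentialPDF_of_nonneg ht,
        ← ENNReal.ofReal_mul (by positivity), ← ENNReal.ofReal_mul (by positivity)]
      congr 1
      rw [mul_assoc, ← Real.exp_add, ← mul_assoc, div_mul_cancel₀ _ (by positivity)]
      ring_nf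
  simp_rw [this]
  rw [lintegral_const_mul' _ _ ENNReal.ofReal_ne_top,
    lintegral_exponentialPDF_eq_one (by positivity), mul_one]

/-- Under a product measure, a coordinate can be drawn again, independently of the others. -/
lemma map_update_infinitePi {ι : Type*} [DecidableEq ι] {X : ι → Type*}
    [∀ i, MeasurableSpace (X i)] (ν : ∀ i, Measure (X i)) [∀ i, IsProbabilityMeasure (ν i)]
    (i : ι) :
    ((Measure.infinitePi ν).prod (ν i)).map (fun q => Function.update q.1 i q.2) =
      Measure.infinitePi ν := by
  refine Measure.eq_infinitePi _ fun s t ht => ?_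
  rw [Measure.map_apply measurable_update' (.pi s.countable_toSet fun j _ => ht j)]
  by_cases hi : i ∈ s
  · have : (fun q : (∀ j, X j) × X i => Function.update q.1 i q.2) ⁻¹' (Set.pi s t) =
        (Set.pi (s.erase i : Finset ι) t) ×ˢ t i := by
      ext q
      simp only [Set.mem_preimage, Set.mem_pi, Set.mem_prod, Finset.mem_coe, Finset.mem_erase]
      constructor
      · intro h
        refine ⟨fun j hj => ?_, ?_⟩
        · simpa [hj.1] using h j hj.2
        · simpa using h i hi
      · rintro ⟨h1, h2⟩ j hj
        by_cases hji : j = i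
        · subst hji
          simpa using h2
        · simpa [hji] using h1 j ⟨hji, hj⟩
    rw [this, Measure.prod_prod, Measure.infinitePi_pi _ (fun j _ => ht j),
      Finset.prod_erase_mul _ _ hi]
  · have : (fun q : (∀ j, X j) × X i => Function.update q.1 i q.2) ⁻¹' (Set.pi s t) =
        (Set.pi s t) ×ˢ Set.univ := by
      ext q
      simp only [Set.mem_preimage, Set.mem_pi, Set.mem_prod, Finset.mem_coe, Set.mem_univ, and_true]
      refine forall₂_congr fun j hj => ?_
      have : j ≠ i := fun h => hi (h ▸ hj)
      simp [this]
    rw [this, Measure.prod_prod, Measure.infinitePi_pi _ (fun j _ => ht j), measure_univ, mul_one]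

/-! ### The law of the inter-event times -/

section

variable (rate : Node → ℝ) [hrate : Fact (∀ s, 0 < rate s)]

lemma rate_pos (s : Node) : 0 < rate s := hrate.out s

instance (s : Node) : IsProbabilityMeasure (expMeasure (rate s)) :=
  isProbabilityMeasure_expMeasure (rate_pos rate s)

/-- The joint law of independent inter-event times which are exponential with rate `rate s` at the
node `s`. The positivity of the rates is supplied as a `Fact`. -/
def law : Measure Gaps := Measure.infinitePi fun p : Node × ℕ => expMeasure (rate p.1)

instance : IsProbabilityMeasure (law rate) := by unfold law; infer_instance

lemma measurePreserving_eval_law (p : Node × ℕ) :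
    MeasurePreserving (fun x : Gaps => x p) (law rate) (expMeasure (rate p.1)) :=
  measurePreserving_eval_infinitePi (fun p : Node × ℕ => expMeasure (rate p.1)) p

lemma measurable_update_gaps (p : Node × ℕ) :
    Measurable fun q : Gaps × ℝ => Function.update q.1 p q.2 := measurable_update'

lemma measurable_update_sub (p : Node × ℕ) (d : ℝ) :
    Measurable fun x : Gaps => Function.update x p (x p - d) := by
  have h : Measurable fun x : Gaps => (x, x p - d) := by fun_prop
  exact (measurable_update_gaps p).comp h

lemma lintegral_law_update (p : Node × ℕ) {F : Gaps → ℝ≥0∞} (hF : Measurable F) :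
    ∫⁻ x, F x ∂(law rate) =
      ∫⁻ x, ∫⁻ t, F (Function.update x p t) ∂(expMeasure (rate p.1)) ∂(law rate) := by
  have h := map_update_infinitePi (fun p : Node × ℕ => expMeasure (rate p.1)) p
  rw [← law] at h
  conv_lhs => rw [← h]
  rw [lintegral_map hF measurable_update',
    lintegral_prod (fun q : Gaps × ℝ => F (Function.update q.1 p q.2))
      (hF.comp (measurable_update_gaps p)).aemeasurable]

/-- The memoryless property for one of the inter-event times. -/
lemma lintegral_law_sub (p : Node × ℕ) {d : ℝ} (hd : 0 ≤ d) {F : Gaps → ℝ≥0∞}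
    (hF : Measurable F) :
    ∫⁻ x, (if d < x p then F (Function.update x p (x p - d)) else 0) ∂(law rate) =
      ENNReal.ofReal (Real.exp (-(rate p.1 * d))) * ∫⁻ x, F x ∂(law rate) := by
  have hm : Measurable fun x : Gaps => if d < x p then F (Function.update x p (x p - d)) else 0 :=
    Measurable.ite (measurableSet_lt measurable_const (measurable_pi_apply p))
      (hF.comp (measurable_update_sub p d)) measurable_const
  rw [lintegral_law_update rate p hm, lintegral_law_update rate p hF,
    ← lintegral_const_mul' _ _ ENNReal.ofReal_ne_top]
  refine lintegral_congr fun x => ?_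
  simp only [Function.update_self, Function.update_idem]
  exact lintegral_expMeasure_sub hd
    (f := fun t => F (Function.update x p t)) (hF.comp (measurable_update x))

/-- Forgetting the first inter-event time at the node `i`. -/
def dropFirst (i : Node) (x : Gaps) : Gaps := fun p => if p.1 = i then x (i, p.2 + 1) else x p

lemma measurable_dropFirst (i : Node) : Measurable (dropFirst i) :=
  measurable_pi_lambda _ fun p => by
    unfold dropFirst
    split_ifs
    · exact measurable_pi_apply _
    · exact measurable_pi_apply _

lemma measurePreserving_dropFirst (i : Node) :
    MeasurePreserving (dropFirst i) (law rate) (law rate) := by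
  refine ⟨measurable_dropFirst i, ?_⟩
  let e : Node × ℕ → Node × ℕ := fun p => if p.1 = i then (p.1, p.2 + 1) else p
  have he : Function.Injective e := by
    rintro ⟨s, k⟩ ⟨s', k'⟩ h
    simp only [e] at h
    split_ifs at h <;> simp_all
  have h1 : dropFirst i = fun x p => x (e p) := by
    funext x p
    simp only [dropFirst, e]
    split_ifs with h
    · rw [← h]
    · rfl
  have h2 := Measure.map_infinitePi_infinitePi_of_inj
    (P := fun p : Node × ℕ => expMeasure (rate p.1)) he
  have h3 : ∀ p, (e p).1 = p.1 := fun p => by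
    simp only [e]
    split_ifs <;> rfl
  rw [h1, law, h2]
  simp only [h3]

lemma measurableSet_isFirst (i : Node) : MeasurableSet {x | IsFirst i x} := by
  have : {x | IsFirst i x} = ⋂ j, {x | j ≠ i → x (i, 0) < x (j, 0)} := by
    ext x
    simp [IsFirst]
  rw [this]
  refine MeasurableSet.iInter fun j => ?_
  by_cases hj : j = i
  · simp [hj]
  · simpa [hj] using measurableSet_lt (measurable_pi_apply (i, 0)) (measurable_pi_apply (j, 0))

lemma measurable_residual (i : Node) : Measurable (residual i) :=
  measurable_pi_lambda _ fun p => by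
    unfold residual
    split_ifs
    · exact measurable_pi_apply _
    · exact (measurable_pi_apply _).sub (measurable_pi_apply _)
    · exact measurable_pi_apply _

lemma measurable_firstNode : Measurable firstNode :=
  Measurable.ite (measurableSet_isFirst _) measurable_const
    (Measurable.ite (measurableSet_isFirst _) measurable_const measurable_const)

lemma measurable_wait : Measurable wait := by
  have : Measurable fun q : Node × Gaps => q.2 (q.1, 0) :=
    measurable_from_prod_countable_right fun i => measurable_pi_apply (i, 0)
  exact this.comp (measurable_firstNode.prodMk measurable_id)

lemma measurable_next : Measurable next := by
  have : Measurable fun q : Node × Gaps => residual q.1 q.2 :=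
    measurable_from_prod_countable_right fun i => measurable_residual i
  exact this.comp (measurable_firstNode.prodMk measurable_id)

open Classical in
/-- The first of all events takes place at `i`: the time of this event has the density
`rate i * exp (-(rate i + rate j + rate k) * t)`, and what comes afterwards has the original law,
whatever this time. -/
lemma lintegral_isFirst_of_ne {i j k : Node} (hij : j ≠ i) (hik : k ≠ i) (hjk : k ≠ j)
    {H : ℝ → Gaps → ℝ≥0∞} (hH : Measurable (Function.uncurry H)) :
    ∫⁻ x, (if IsFirst i x then H (x (i, 0)) (residual i x) else 0) ∂(law rate) =
      ∫⁻ t, ENNReal.ofReal (Real.exp (-((rate j + rate k) * t))) * ∫⁻ y, H t y ∂(law rate)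
        ∂(expMeasure (rate i)) := by
  have hall : ∀ s, s = i ∨ s = j ∨ s = k := by
    intro s
    cases i <;> cases j <;> cases k <;> cases s <;> simp_all
  have hm : Measurable fun x : Gaps =>
      if IsFirst i x then H (x (i, 0)) (residual i x) else 0 :=
    Measurable.ite (measurableSet_isFirst i)
      (hH.comp ((measurable_pi_apply (i, 0)).prodMk (measurable_residual i))) measurable_const
  -- condition on the time `t` of the first event at `i`, a coordinate independent of all others
  rw [lintegral_law_update rate (i, 0) hm, lintegral_lintegral_swap
    (f := fun x t => if IsFirst i (Function.update x (i, 0) t) then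
      H (Function.update x (i, 0) t (i, 0)) (residual i (Function.update x (i, 0) t)) else 0)
    (hm.comp (measurable_update_gaps (i, 0))).aemeasurable]
  refine lintegral_congr_ae ?_
  filter_upwards [ae_pos_expMeasure (rate i)] with t ht
  have hHt : Measurable (H t) := hH.comp measurable_prodMk_left
  -- given `t`, only the first times at `k` (in `G`) and at `j` (in `G'`) are compared with `t` and
  -- lowered by `t`, so that the memoryless property applies to one after the other
  let G : Gaps → ℝ≥0∞ := fun x =>
    if t < x (k, 0) then H t (Function.update x (k, 0) (x (k, 0) - t)) else 0
  have hG : Measurable G :=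
    Measurable.ite (measurableSet_lt measurable_const (measurable_pi_apply _))
      (hHt.comp (measurable_update_sub _ t)) measurable_const
  let G' : Gaps → ℝ≥0∞ := fun x =>
    if t < x (j, 0) then G (Function.update x (j, 0) (x (j, 0) - t)) else 0
  have hG' : Measurable G' :=
    Measurable.ite (measurableSet_lt measurable_const (measurable_pi_apply _))
      (hG.comp (measurable_update_sub _ t)) measurable_const
  have hmain : ∀ x : Gaps, (if IsFirst i (Function.update x (i, 0) t) then
      H (Function.update x (i, 0) t (i, 0)) (residual i (Function.update x (i, 0) t)) else 0) =
      G' (dropFirst i x) := by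
    intro x
    have hfirst : IsFirst i (Function.update x (i, 0) t) ↔ t < x (j, 0) ∧ t < x (k, 0) := by
      constructor
      · intro h
        have h1 := h j hij
        have h2 := h k hik
        simp_all
      · rintro ⟨h1, h2⟩ s hs
        rcases hall s with rfl | rfl | rfl
        · exact absurd rfl hs
        · simpa [Function.update_apply, hs] using h1
        · simpa [Function.update_apply, hs] using h2
    have hres : residual i (Function.update x (i, 0) t) =
        Function.update (Function.update (dropFirst i x) (j, 0) (x (j, 0) - t)) (k, 0)
          (x (k, 0) - t) := by
      funext p
      obtain ⟨s, n⟩ := p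
      rcases hall s with rfl | rfl | rfl
      · simp [residual, dropFirst, Ne.symm hij, Ne.symm hik]
      · cases n <;> simp [residual, dropFirst, hij, Ne.symm hjk]
      · cases n <;> simp [residual, dropFirst, hik]
    have hdj : dropFirst i x (j, 0) = x (j, 0) := by simp [dropFirst, hij]
    have hdk : dropFirst i x (k, 0) = x (k, 0) := by simp [dropFirst, hik]
    have hjk' : ((k, 0) : Node × ℕ) ≠ (j, 0) := by simp [hjk]
    simp only [G', G, hdj, Function.update_of_ne hjk', hdk, hres, Function.update_self, hfirst]
    by_cases h1 : t < x (j, 0) <;> by_cases h2 : t < x (k, 0) <;> simp [h1, h2]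
  simp_rw [hmain]
  rw [(measurePreserving_dropFirst rate i).lintegral_comp hG',
    lintegral_law_sub rate (j, 0) ht.le hG, lintegral_law_sub rate (k, 0) ht.le hHt, ← mul_assoc,
    ← ENNReal.ofReal_mul (Real.exp_pos _).le, ← Real.exp_add]
  congr 3
  simp only
  ring

end

section

variable (rate : Node → ℝ) [hrate : Fact (∀ s, 0 < rate s)]

/-! ### Regularity of almost all samples -/

lemma ae_pos_law : ∀ᵐ x ∂(law rate), ∀ p, 0 < x p := by
  rw [ae_all_iff]
  exact fun p => (measurePreserving_eval_law rate p).quasiMeasurePreserving.ae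
    (ae_pos_expMeasure (rate p.1))

lemma ae_ne_law {p q : Node × ℕ} (hpq : p ≠ q) : ∀ᵐ x ∂(law rate), x p ≠ x q := by
  have hm : MeasurableSet {x : Gaps | x p = x q} :=
    measurableSet_eq_fun (measurable_pi_apply p) (measurable_pi_apply q)
  have hnull : law rate {x : Gaps | x p = x q} = 0 := by
    rw [← lintegral_indicator_one hm, lintegral_law_update rate p
      (measurable_one.indicator hm), lintegral_eq_zero_of_ae_eq_zero]
    -- once `x q` is fixed, a fresh draw of the coordinate `p` avoids this value almost surely
    refine ae_of_all _ fun x => lintegral_eq_zero_of_ae_eq_zero ?_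
    have : ∀ᵐ t ∂(expMeasure (rate p.1)), t ≠ x q :=
      (expMeasure_absolutelyContinuous _).ae_le
        ((Set.countable_singleton (x q)).ae_notMem volume)
    filter_upwards [this] with t ht
    simp [Function.update_of_ne (Ne.symm hpq), ht]
  rw [ae_iff]
  simpa using hnull

lemma exists_isFirst {x : Gaps} (hx : ∀ i j : Node, i ≠ j → x (i, 0) ≠ x (j, 0)) :
    ∃ i, IsFirst i x := by
  obtain ⟨i, -, hi⟩ := Finset.exists_min_image Finset.univ (fun i : Node => x (i, 0))
    ⟨Node.source, Finset.mem_univ _⟩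
  exact ⟨i, fun j hj => lt_of_le_of_ne (hi j (Finset.mem_univ _)) (hx i j (Ne.symm hj))⟩

lemma integrable_eval_law (p : Node × ℕ) : Integrable (fun x : Gaps => x p) (law rate) := by
  have h : Integrable (fun t : ℝ => t) (expMeasure (rate p.1)) := by
    refine ⟨measurable_id.aestronglyMeasurable, ?_⟩
    rw [hasFiniteIntegral_iff_ofReal ((ae_pos_expMeasure _).mono fun t ht => ht.le),
      lintegral_ofReal_expMeasure (rate_pos rate _)]
    exact ENNReal.ofReal_lt_top
  exact (measurePreserving_eval_law rate p).integrable_comp_of_integrable h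

lemma integral_eval_law_pos (p : Node × ℕ) : 0 < ∫ x, x p ∂(law rate) := by
  have h0 : 0 ≤ᵐ[law rate] fun x => x p := (ae_pos_law rate).mono fun x hx => (hx p).le
  refine lt_of_le_of_ne (integral_nonneg_of_ae h0) fun h => ?_
  have h' := (integral_eq_zero_iff_of_nonneg_ae h0 (integrable_eval_law rate p)).1 h.symm
  obtain ⟨x, hx, hx'⟩ := (h'.and (ae_pos_law rate)).exists
  exact (hx' p).ne' hx

/-- There is no explosion, by the strong law of large numbers. -/
lemma ae_tendsto_eventTime (s : Node) :
    ∀ᵐ x ∂(law rate), Tendsto (eventTime (Function.curry x s)) atTop atTop := by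
  have hlaw := strong_law_ae_real (μ := law rate) (fun k x => x (s, k))
    (integrable_eval_law rate (s, 0)) (fun k l hkl =>
      (iIndepFun_infinitePi (P := fun p : Node × ℕ => expMeasure (rate p.1))
        (X := fun _ t => t) fun _ => measurable_id).indepFun (by simpa using hkl))
    (fun k => ⟨(measurable_pi_apply _).aemeasurable, (measurable_pi_apply _).aemeasurable, by
      rw [(measurePreserving_eval_law rate (s, k)).map_eq,
        (measurePreserving_eval_law rate (s, 0)).map_eq]⟩)
  filter_upwards [hlaw] with x hx
  have h1 : Tendsto (fun n : ℕ => (n : ℝ) * ((∑ i ∈ Finset.range n, x (s, i)) / n)) atTop atTop :=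
    tendsto_natCast_atTop_atTop.atTop_mul_pos (integral_eval_law_pos rate (s, 0)) hx
  have h2 : Tendsto (fun n : ℕ => ∑ i ∈ Finset.range n, x (s, i)) atTop atTop := by
    refine h1.congr' ?_
    filter_upwards [eventually_gt_atTop 0] with n hn
    have : (n : ℝ) ≠ 0 := by positivity
    field_simp
  exact h2.comp (tendsto_add_atTop_nat 1)

lemma ae_isRegular : ∀ᵐ x ∂(law rate), IsRegular x := by
  have hne : ∀ᵐ x ∂(law rate), ∀ i j : Node, i ≠ j → x (i, 0) ≠ x (j, 0) := by
    rw [ae_all_iff]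
    intro i
    rw [ae_all_iff]
    intro j
    by_cases hij : i = j
    · simp [hij]
    · filter_upwards [ae_ne_law rate (p := (i, 0)) (q := (j, 0)) (by simpa using hij)] with x hx _
      exact hx
  filter_upwards [ae_pos_law rate, hne, ae_all_iff.2 (ae_tendsto_eventTime rate)] with x h1 h2 h3
  exact ⟨h1, exists_isFirst h2, h3⟩

/-! ### One step of the merged stream -/

lemma sum_node {M : Type*} [AddCommMonoid M] (f : Node → M) :
    ∑ i, f i = f Node.source + (f Node.cache + f Node.user) := by
  change ∑ i ∈ {Node.source, Node.cache, Node.user}, f i = _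
  rw [Finset.sum_insert (by simp), Finset.sum_insert (by simp), Finset.sum_singleton]

/-- The total rate of the events at the other nodes. -/
def otherRates (i : Node) : ℝ := (∑ j, rate j) - rate i

open Classical in
lemma lintegral_isFirst (i : Node) {H : ℝ → Gaps → ℝ≥0∞}
    (hH : Measurable (Function.uncurry H)) :
    ∫⁻ x, (if IsFirst i x then H (x (i, 0)) (residual i x) else 0) ∂(law rate) =
      ∫⁻ t, ENNReal.ofReal (Real.exp (-(otherRates rate i * t))) * ∫⁻ y, H t y ∂(law rate)
        ∂(expMeasure (rate i)) := by
  cases i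
  · rw [show otherRates rate Node.source = rate Node.cache + rate Node.user by
      rw [otherRates, sum_node]; ring]
    exact lintegral_isFirst_of_ne rate (by simp) (by simp) (by simp) hH
  · rw [show otherRates rate Node.cache = rate Node.source + rate Node.user by
      rw [otherRates, sum_node]; ring]
    exact lintegral_isFirst_of_ne rate (by simp) (by simp) (by simp) hH
  · rw [show otherRates rate Node.user = rate Node.source + rate Node.cache by
      rw [otherRates, sum_node]; ring]
    exact lintegral_isFirst_of_ne rate (by simp) (by simp) (by simp) hH

open Classical in
lemma lintegral_eq_sum_isFirst {F : Node → Gaps → ℝ≥0∞} (hF : ∀ i, Measurable (F i)) :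
    ∫⁻ x, F (firstNode x) x ∂(law rate) =
      ∑ i, ∫⁻ x, (if IsFirst i x then F i x else 0) ∂(law rate) := by
  rw [← lintegral_finsetSum _ fun i _ =>
    Measurable.ite (measurableSet_isFirst i) (hF i) measurable_const]
  refine lintegral_congr_ae ?_
  filter_upwards [ae_isRegular rate] with x hx
  rw [Finset.sum_eq_single (firstNode x), if_pos hx.isFirst]
  · intro i _ hi
    rw [if_neg fun h => hi h.firstNode_eq.symm]
  · exact fun h => absurd (Finset.mem_univ _) h

/-- The inter-event times that an observer meets from the first of all events on have the original
law, and they are independent of the time and the node of this event. -/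
theorem lintegral_step {H : Node → ℝ → Gaps → ℝ≥0∞}
    (hH : ∀ i, Measurable (Function.uncurry (H i))) :
    ∫⁻ x, H (firstNode x) (wait x) (next x) ∂(law rate) =
      ∫⁻ x, ∫⁻ y, H (firstNode x) (wait x) y ∂(law rate) ∂(law rate) := by
  have hint : ∀ i, Measurable fun t => ∫⁻ y, H i t y ∂(law rate) := fun i =>
    (hH i).lintegral_prod_right'
  calc ∫⁻ x, H (firstNode x) (wait x) (next x) ∂(law rate)
      = ∑ i, ∫⁻ t, ENNReal.ofReal (Real.exp (-(otherRates rate i * t))) *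
          ∫⁻ y, H i t y ∂(law rate) ∂(expMeasure (rate i)) := by
        have h1 := lintegral_eq_sum_isFirst rate (F := fun i x => H i (x (i, 0)) (residual i x))
          fun i => (hH i).comp ((measurable_pi_apply (i, 0)).prodMk (measurable_residual i))
        exact h1.trans (Finset.sum_congr rfl fun i _ => lintegral_isFirst rate i (hH i))
    _ = ∫⁻ x, ∫⁻ y, H (firstNode x) (wait x) y ∂(law rate) ∂(law rate) := by
        have h1 := lintegral_eq_sum_isFirst rate
          (F := fun i x => ∫⁻ y, H i (x (i, 0)) y ∂(law rate))
          fun i => (hint i).comp (measurable_pi_apply (i, 0))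
        refine (h1.trans (Finset.sum_congr rfl fun i _ => ?_)).symm
        have h2 := lintegral_isFirst rate i (H := fun t _ => ∫⁻ y, H i t y ∂(law rate))
          ((hint i).comp measurable_fst)
        simpa using h2

lemma measurePreserving_next : MeasurePreserving next (law rate) (law rate) := by
  refine ⟨measurable_next, Measure.ext_of_lintegral _ fun f hf => ?_⟩
  rw [lintegral_map hf measurable_next]
  have := lintegral_step rate (H := fun _ _ y => f y) fun _ => hf.comp measurable_snd
  simpa using this

/-- The probability that the first of all events takes place at the node `i`. -/
def nodeProb (i : Node) : ℝ := rate i / ∑ j, rate j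

lemma sum_rate_pos : 0 < ∑ j, rate j :=
  Finset.sum_pos (fun j _ => rate_pos rate j) ⟨Node.source, Finset.mem_univ _⟩

lemma nodeProb_pos (i : Node) : 0 < nodeProb rate i := div_pos (rate_pos rate i) (sum_rate_pos rate)

lemma sum_nodeProb : nodeProb rate Node.source + (nodeProb rate Node.cache +
    nodeProb rate Node.user) = 1 := by
  rw [← sum_node (nodeProb rate)]
  simp only [nodeProb]
  rw [← Finset.sum_div, div_self (sum_rate_pos rate).ne']

/-- The first of all events takes place at a node with a probability proportional to its rate. -/
lemma lintegral_firstNode (f : Node → ℝ≥0∞) :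
    ∫⁻ x, f (firstNode x) ∂(law rate) = ∑ i, ENNReal.ofReal (nodeProb rate i) * f i := by
  classical
  have h1 := lintegral_eq_sum_isFirst rate (F := fun i _ => f i) fun _ => measurable_const
  refine h1.trans (Finset.sum_congr rfl fun i _ => ?_)
  have h2 := lintegral_isFirst rate i (H := fun _ _ => f i) measurable_const
  have h3 : 0 ≤ otherRates rate i := by
    rw [otherRates, sub_nonneg]
    exact Finset.single_le_sum (fun j _ => (rate_pos rate j).le) (Finset.mem_univ i)
  simp only [lintegral_const, measure_univ, mul_one] at h2
  rw [h2, lintegral_mul_const _ (by fun_prop),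
    lintegral_exp_neg_mul_expMeasure (rate_pos rate i) h3, otherRates, add_sub_cancel,
    nodeProb]

lemma lintegral_wait_ne_top : ∫⁻ x, ENNReal.ofReal (wait x) ∂(law rate) ≠ ∞ := by
  have h : ∫⁻ x, ENNReal.ofReal (wait x) ∂(law rate) ≤
      ∫⁻ x, ENNReal.ofReal (x (Node.source, 0)) ∂(law rate) := by
    refine lintegral_mono_ae ?_
    filter_upwards [ae_isRegular rate] with x hx
    exact ENNReal.ofReal_le_ofReal (hx.wait_le Node.source)
  have h' := (measurePreserving_eval_law rate (Node.source, 0)).lintegral_comp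
    ENNReal.measurable_ofReal
  rw [h', lintegral_ofReal_expMeasure (rate_pos rate _)] at h
  exact (h.trans_lt ENNReal.ofReal_lt_top).ne

lemma lintegral_wait_ne_zero : ∫⁻ x, ENNReal.ofReal (wait x) ∂(law rate) ≠ 0 := by
  rw [Ne, lintegral_eq_zero_iff measurable_wait.ennreal_ofReal]
  intro h
  obtain ⟨x, hx, hx'⟩ := (h.and (ae_isRegular rate)).exists
  exact absurd hx (by simpa using hx'.wait_pos)

end

/-! ### Expected rewards -/

lemma measurable_partialReward (r : Status → ℝ≥0∞) {w : Gaps → ℝ≥0∞} (hw : Measurable w) (n : ℕ)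
    (s : Status) : Measurable (partialReward r w n s) := by
  induction n generalizing s with
  | zero => exact measurable_const
  | succ n ih =>
    refine (hw.const_mul (r s)).add ?_
    have : Measurable fun q : Node × Gaps =>
        if Succeeds s q.1 then 0 else partialReward r w n (s.step q.1) q.2 :=
      measurable_from_prod_countable_right fun i => by
        by_cases h : Succeeds s i
        · simp [h]
        · simpa [h] using ih _
    exact this.comp (measurable_firstNode.prodMk measurable_next)

lemma measurable_reward (r : Status → ℝ≥0∞) {w : Gaps → ℝ≥0∞} (hw : Measurable w)
    (s : Status) : Measurable (reward r w s) :=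
  Measurable.iSup fun n => measurable_partialReward r hw n s

lemma measurable_timeToSuccess (r : Status → ℝ≥0∞) (s : Status) :
    Measurable (timeToSuccess r s) :=
  measurable_reward r measurable_wait.ennreal_ofReal s

lemma lintegral_reward_eq_iSup (μ : Measure Gaps) (r : Status → ℝ≥0∞) {w : Gaps → ℝ≥0∞}
    (hw : Measurable w) (s : Status) :
    ∫⁻ x, reward r w s x ∂μ = ⨆ n, ∫⁻ x, partialReward r w n s x ∂μ :=
  lintegral_iSup (fun n => measurable_partialReward r hw n s) fun _ _ hmn x =>
    partialReward_mono r w s x hmn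

section

variable (rate : Node → ℝ) [hrate : Fact (∀ s, 0 < rate s)]

/-- First-step analysis: the expectation of a quantity that is built from a contribution of the
present and, unless the first event is a successful update, a quantity `G` of the future. -/
lemma lintegral_first_step (r : Status → ℝ≥0∞) {w : Gaps → ℝ≥0∞} (hw : Measurable w)
    {G : Status → Gaps → ℝ≥0∞} (hG : ∀ s, Measurable (G s)) (s : Status) :
    ∫⁻ x, (r s * w x + if Succeeds s (firstNode x) then 0 else G (s.step (firstNode x)) (next x))
        ∂(law rate) = r s * ∫⁻ x, w x ∂(law rate) +
      ∑ i, ENNReal.ofReal (nodeProb rate i) * if Succeeds s i then 0 else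
        ∫⁻ x, G (s.step i) x ∂(law rate) := by
  rw [lintegral_add_left (hw.const_mul _), lintegral_const_mul _ hw]
  congr 1
  have h1 := lintegral_step rate (H := fun i _ y =>
    if Succeeds s i then 0 else G (s.step i) y) fun i => by
      by_cases h : Succeeds s i
      · simp [h, Function.uncurry_def]
      · simp only [h, if_false, Function.uncurry_def]
        exact (hG (s.step i)).comp measurable_snd
  rw [h1, ← lintegral_firstNode rate (fun i => if Succeeds s i then 0 else
        ∫⁻ x, G (s.step i) x ∂(law rate))]
  refine lintegral_congr fun x => ?_
  split_ifs <;> simp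

lemma lintegral_partialReward_succ (r : Status → ℝ≥0∞) {w : Gaps → ℝ≥0∞} (hw : Measurable w)
    (n : ℕ) (s : Status) :
    ∫⁻ x, partialReward r w (n + 1) s x ∂(law rate) = r s * ∫⁻ x, w x ∂(law rate) +
      ∑ i, ENNReal.ofReal (nodeProb rate i) * if Succeeds s i then 0 else
        ∫⁻ x, partialReward r w n (s.step i) x ∂(law rate) :=
  lintegral_first_step rate r hw (measurable_partialReward r hw n) s

lemma lintegral_reward (r : Status → ℝ≥0∞) {w : Gaps → ℝ≥0∞} (hw : Measurable w) (s : Status) :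
    ∫⁻ x, reward r w s x ∂(law rate) = r s * ∫⁻ x, w x ∂(law rate) +
      ∑ i, ENNReal.ofReal (nodeProb rate i) * if Succeeds s i then 0 else
        ∫⁻ x, reward r w (s.step i) x ∂(law rate) :=
  (lintegral_congr fun x => reward_eq r w s x).trans
    (lintegral_first_step rate r hw (measurable_reward r hw) s)

/-- The solution of the equations of the first-step analysis for the number of merged events up to
the first successful update. -/
def expectedSteps : Status → ℝ
  | Status.stale => 1 / (nodeProb rate Node.cache * nodeProb rate Node.user)
  | Status.cached => (nodeProb rate Node.cache + nodeProb rate Node.source) /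
      (nodeProb rate Node.cache * nodeProb rate Node.user)
  | Status.fresh => 1 / nodeProb rate Node.source +
      1 / (nodeProb rate Node.cache * nodeProb rate Node.user)

lemma expectedSteps_nonneg (s : Status) : 0 ≤ expectedSteps rate s := by
  have := nodeProb_pos rate
  cases s <;> simp only [expectedSteps]
  · have h1 := this Node.cache; have h2 := this Node.user
    positivity
  · have h1 := this Node.cache; have h2 := this Node.user; have h3 := this Node.source
    positivity
  · have h1 := this Node.cache; have h2 := this Node.user; have h3 := this Node.source
    positivity

lemma expectedSteps_eq (s : Status) : expectedSteps rate s = 1 + ∑ i, nodeProb rate i *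
    if Succeeds s i then 0 else expectedSteps rate (s.step i) := by
  have h1 := nodeProb_pos rate Node.source
  have h2 := nodeProb_pos rate Node.cache
  have h3 := nodeProb_pos rate Node.user
  have h := sum_nodeProb rate
  rw [sum_node]
  cases s <;> simp [Succeeds, Status.step, expectedSteps]
  · field_simp
    linear_combination (-(1 + nodeProb rate Node.cache)) * h
  · field_simp
    linear_combination (-nodeProb rate Node.cache) * h
  · field_simp
    linear_combination
      (-(nodeProb rate Node.source + nodeProb rate Node.cache * nodeProb rate Node.user)) * h

/-- Truncated rewards stay below the solution of the first-step equations. So the expected rewards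
are finite, which these equations alone do not imply in `ℝ≥0∞`. -/
lemma lintegral_partialReward_le {w : Gaps → ℝ≥0∞} (hw : Measurable w) (n : ℕ) (s : Status) :
    ∫⁻ x, partialReward always w n s x ∂(law rate) ≤
      ENNReal.ofReal (expectedSteps rate s) * ∫⁻ x, w x ∂(law rate) := by
  induction n generalizing s with
  | zero => simp [partialReward]
  | succ n ih =>
    have hnn : ∀ i, 0 ≤ if Succeeds s i then 0 else expectedSteps rate (s.step i) := fun i => by
      split_ifs
      · exact le_rfl
      · exact expectedSteps_nonneg rate _
    rw [lintegral_partialReward_succ rate always hw, expectedSteps_eq rate s,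
      ENNReal.ofReal_add zero_le_one (Finset.sum_nonneg fun i _ =>
        mul_nonneg (nodeProb_pos rate i).le (hnn i)), ENNReal.ofReal_one, add_mul, always,
      ENNReal.ofReal_sum_of_nonneg fun i _ => mul_nonneg (nodeProb_pos rate i).le (hnn i),
      Finset.sum_mul]
    refine add_le_add le_rfl (Finset.sum_le_sum fun i _ => ?_)
    rw [ENNReal.ofReal_mul (nodeProb_pos rate i).le, mul_assoc]
    gcongr
    split_ifs
    · simp
    · exact ih _

lemma lintegral_reward_always_ne_top {w : Gaps → ℝ≥0∞} (hw : Measurable w)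
    (hfin : ∫⁻ x, w x ∂(law rate) ≠ ∞) (s : Status) :
    ∫⁻ x, reward always w s x ∂(law rate) ≠ ∞ := by
  rw [lintegral_reward_eq_iSup _ always hw]
  exact ((iSup_le fun n => lintegral_partialReward_le rate hw n s).trans_lt
    (ENNReal.mul_lt_top ENNReal.ofReal_lt_top hfin.lt_top)).ne

lemma partialReward_le_always {r : Status → ℝ≥0∞} (hr : r ≤ always) (w : Gaps → ℝ≥0∞) (n : ℕ)
    (s : Status) (x : Gaps) : partialReward r w n s x ≤ partialReward always w n s x := by
  induction n generalizing s x with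
  | zero => exact le_rfl
  | succ n ih =>
    rw [partialReward_succ, partialReward_succ]
    gcongr
    · exact hr s
    · split_ifs
      · exact le_rfl
      · exact ih _ _

lemma lintegral_timeToSuccess_ne_top {r : Status → ℝ≥0∞} (hr : r ≤ always) (s : Status) :
    ∫⁻ x, timeToSuccess r s x ∂(law rate) ≠ ∞ :=
  ((lintegral_mono fun x => iSup_mono fun n => partialReward_le_always hr _ n s x).trans_lt
    (lintegral_reward_always_ne_top rate measurable_wait.ennreal_ofReal
      (lintegral_wait_ne_top rate) s).lt_top).ne

lemma onlyFresh_le_always : onlyFresh ≤ always := fun s => by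
  unfold onlyFresh always
  split_ifs <;> simp

/-! ### Almost all samples are good -/

lemma le_partialReward_of_not_hit {n : ℕ} {s : Status} {x : Gaps} (h : ∀ k, ¬ Hit k s x) :
    (n : ℝ≥0∞) ≤ partialReward always (fun _ => 1) n s x := by
  induction n generalizing s x with
  | zero => simp
  | succ n ih =>
    rw [partialReward_succ, if_neg (show ¬ Succeeds s (firstNode x) from h 0), always, mul_one,
      Nat.cast_succ, add_comm]
    gcongr
    exact ih fun k => h (k + 1)

/-- Without a successful update the number of steps up to it, which has a finite expectation, would
be infinite. -/
lemma ae_exists_hit (s : Status) : ∀ᵐ x ∂(law rate), ∃ k, Hit k s x := by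
  have hfin := lintegral_reward_always_ne_top rate (w := fun _ => 1) measurable_const (by simp) s
  filter_upwards [ae_lt_top (measurable_reward always measurable_const s) hfin] with x hx
  by_contra h
  push Not at h
  refine hx.ne (ENNReal.eq_top_of_forall_nnreal_le fun q => ?_)
  obtain ⟨n, hn⟩ := exists_nat_ge q
  calc (q : ℝ≥0∞) ≤ (n : ℝ≥0∞) := by exact_mod_cast hn
    _ ≤ _ := le_partialReward_of_not_hit h
    _ ≤ _ := le_iSup (fun n => partialReward always (fun _ => 1) n s x) n

lemma ae_isGood : ∀ᵐ x ∂(law rate), IsGood x := by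
  refine ae_all_iff.2 fun n => ?_
  refine ((measurePreserving_next rate).iterate n).quasiMeasurePreserving.ae
    (p := fun y => IsRegular y ∧ ∀ s, ∃ k, Hit k s y) ?_
  filter_upwards [ae_isRegular rate, ae_all_iff.2 (ae_exists_hit rate)] with x h1 h2
  exact ⟨h1, h2⟩

/-! ### Regeneration at successful updates -/

lemma measurable_hit (n : ℕ) (s : Status) : Measurable (Hit n s) := by
  induction n generalizing s with
  | zero => exact (measurable_of_countable (Succeeds s)).comp measurable_firstNode
  | succ n ih =>
    have : Measurable fun q : Node × Gaps => Hit n (s.step q.1) q.2 :=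
      measurable_from_prod_countable_right fun i => ih (s.step i)
    exact this.comp (measurable_firstNode.prodMk measurable_next)

lemma measurable_afterSuccess (s : Status) : Measurable (afterSuccess s) := by
  have hN : Measurable fun x => sInf {n | Hit n s x} := by
    refine measurable_to_countable' fun n => ?_
    have : (fun x => sInf {n | Hit n s x}) ⁻¹' {n} =
        {x | (Hit n s x ∧ ∀ k, k < n → ¬ Hit k s x) ∨ (n = 0 ∧ ∀ k, ¬ Hit k s x)} := by
      ext x
      simp only [Set.mem_preimage, Set.mem_singleton_iff, Set.mem_ofPred_eq]
      constructor
      · rintro rfl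
        rcases Set.eq_empty_or_nonempty {n | Hit n s x} with h | h
        · right
          exact ⟨by rw [h, Nat.sInf_empty], fun k hk => by
            have : k ∈ {n | Hit n s x} := hk
            simp [h] at this⟩
        · exact Or.inl ⟨Nat.sInf_mem h, fun k hk => Nat.notMem_of_lt_sInf hk⟩
      · rintro (⟨h1, h2⟩ | ⟨rfl, h2⟩)
        · refine le_antisymm (Nat.sInf_le h1) (not_lt.1 fun hlt => ?_)
          exact h2 _ hlt (Nat.sInf_mem (s := {n | Hit n s x}) ⟨n, h1⟩)
        · simp [h2]
    rw [this]
    have hm := fun k => measurable_hit k s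
    refine measurableSet_setOfPred.2 ?_
    fun_prop
  have : Measurable fun q : ℕ × Gaps => next^[q.1 + 1] q.2 :=
    measurable_from_prod_countable_right fun n => measurable_next.iterate (n + 1)
  exact this.comp (hN.prodMk measurable_id)

/-- A successful update takes place among the first `n` merged events. -/
def HitBefore (n : ℕ) (s : Status) (x : Gaps) : Prop := ∃ k < n, Hit k s x

lemma measurable_hitBefore (n : ℕ) (s : Status) : Measurable (HitBefore n s) := by
  have hm := fun k => measurable_hit k s
  unfold HitBefore
  fun_prop

lemma hitBefore_succ (n : ℕ) (s : Status) (x : Gaps) : HitBefore (n + 1) s x ↔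
    Succeeds s (firstNode x) ∨ HitBefore n (s.step (firstNode x)) (next x) := by
  constructor
  · rintro ⟨_ | k, hk, h⟩
    · exact Or.inl h
    · exact Or.inr ⟨k, by lia, h⟩
  · rintro (h | ⟨k, hk, h⟩)
    · exact ⟨0, by lia, h⟩
    · exact ⟨k + 1, by lia, h⟩

lemma timeToSuccess_eq (r : Status → ℝ≥0∞) (s : Status) (x : Gaps) :
    timeToSuccess r s x = r s * ENNReal.ofReal (wait x) +
      if Succeeds s (firstNode x) then 0 else timeToSuccess r (s.step (firstNode x)) (next x) :=
  reward_eq r _ s x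

open Classical in
/-- The strong Markov property at the first successful update, on the event that it comes within `n`
steps. The arbitrary function `g` allows to absorb the time before the first event in the induction
on `n`. -/
lemma lintegral_hitBefore (r : Status → ℝ≥0∞) (n : ℕ) (s : Status) {g : ℝ≥0∞ → ℝ≥0∞}
    (hg : Measurable g) {f : Gaps → ℝ≥0∞} (hf : Measurable f) :
    ∫⁻ x, (if HitBefore n s x then g (timeToSuccess r s x) * f (afterSuccess s x) else 0)
        ∂(law rate) =
      (∫⁻ x, (if HitBefore n s x then g (timeToSuccess r s x) else 0) ∂(law rate)) *
        ∫⁻ x, f x ∂(law rate) := by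
  induction n generalizing s g with
  | zero => simp [HitBefore]
  | succ n ih =>
    -- the integrand on the left (with a general `f`) and on the right (with `f = 1`), as a function
    -- of the first event and of what follows
    let H : (Gaps → ℝ≥0∞) → Node → ℝ → Gaps → ℝ≥0∞ := fun f i t y =>
      if Succeeds s i then g (r s * ENNReal.ofReal t) * f y
      else if HitBefore n (s.step i) y then
        g (r s * ENNReal.ofReal t + timeToSuccess r (s.step i) y) * f (afterSuccess (s.step i) y)
      else 0
    have hH : ∀ f : Gaps → ℝ≥0∞, Measurable f → ∀ i, Measurable (Function.uncurry (H f i)) := by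
      intro f hf i
      have h1 : Measurable fun q : ℝ × Gaps => r s * ENNReal.ofReal q.1 := by fun_prop
      by_cases h : Succeeds s i
      · simp only [H, h, if_true, Function.uncurry_def]
        exact (hg.comp h1).mul (hf.comp measurable_snd)
      · simp only [H, h, if_false, Function.uncurry_def]
        refine Measurable.ite (measurableSet_setOfPred.2
          ((measurable_hitBefore n (s.step i)).comp measurable_snd)) ?_ measurable_const
        exact (hg.comp (h1.add ((measurable_timeToSuccess r _).comp measurable_snd))).mul
          (hf.comp ((measurable_afterSuccess _).comp measurable_snd))
    have hleft : ∀ f : Gaps → ℝ≥0∞, Measurable f →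
        ∫⁻ x, (if HitBefore (n + 1) s x then g (timeToSuccess r s x) * f (afterSuccess s x) else 0)
          ∂(law rate) = ∫⁻ x, ∫⁻ y, H f (firstNode x) (wait x) y ∂(law rate) ∂(law rate) := by
      intro f hf
      rw [← lintegral_step rate (hH f hf)]
      refine lintegral_congr_ae ?_
      filter_upwards [ae_isGood rate] with x hx
      simp only [H, hitBefore_succ, timeToSuccess_eq r s x]
      by_cases h : Succeeds s (firstNode x)
      · simp [h, afterSuccess_of_succeeds h]
      · simp [h, afterSuccess_of_not_succeeds h (hx.next.exists_hit _)]
    have hinner : ∀ i t, ∫⁻ y, H f i t y ∂(law rate) =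
        (∫⁻ y, H (fun _ => 1) i t y ∂(law rate)) * ∫⁻ x, f x ∂(law rate) := by
      intro i t
      by_cases h : Succeeds s i
      · simp only [H, h, if_true, mul_one]
        rw [lintegral_const_mul _ hf, lintegral_const, measure_univ, mul_one]
      · simp only [H, h, if_false, mul_one]
        exact ih (s.step i) (g := fun z => g (r s * ENNReal.ofReal t + z)) (by fun_prop)
    have hone := hleft (fun _ => 1) measurable_const
    simp only [mul_one] at hone
    rw [hleft f hf, hone]
    simp only [hinner]
    refine lintegral_mul_const _ ?_
    have : Measurable fun q : Node × ℝ => ∫⁻ y, H (fun _ => 1) q.1 q.2 y ∂(law rate) :=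
      measurable_from_prod_countable_right fun i => (hH _ measurable_const i).lintegral_prod_right'
    exact this.comp (measurable_firstNode.prodMk measurable_wait)

open Classical in
lemma tendsto_lintegral_hitBefore (s : Status) {F : Gaps → ℝ≥0∞} (hF : Measurable F) :
    Tendsto (fun n => ∫⁻ x, (if HitBefore n s x then F x else 0) ∂(law rate)) atTop
      (𝓝 (∫⁻ x, F x ∂(law rate))) := by
  refine lintegral_tendsto_of_tendsto_of_monotone (fun n => (Measurable.ite
    (measurableSet_setOfPred.2 (measurable_hitBefore n s)) hF measurable_const).aemeasurable)
    (ae_of_all _ fun x m n hmn => ?_) ?_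
  · by_cases h : HitBefore m s x
    · have h' : HitBefore n s x := by
        obtain ⟨k, hk, h⟩ := h
        exact ⟨k, hk.trans_le hmn, h⟩
      simp [h, h']
    · simp [h]
  · filter_upwards [ae_exists_hit rate s] with x ⟨k, hk⟩
    refine tendsto_const_nhds.congr' ?_
    filter_upwards [eventually_gt_atTop k] with n hn
    rw [if_pos ⟨k, hn, hk⟩]

/-- What follows a successful update is independent of the time before it and has the original
law. -/
theorem lintegral_afterSuccess (r : Status → ℝ≥0∞) (s : Status) {g : ℝ≥0∞ → ℝ≥0∞}
    (hg : Measurable g) {f : Gaps → ℝ≥0∞} (hf : Measurable f)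
    (hfin : ∫⁻ x, f x ∂(law rate) ≠ ∞) :
    ∫⁻ x, g (timeToSuccess r s x) * f (afterSuccess s x) ∂(law rate) =
      (∫⁻ x, g (timeToSuccess r s x) ∂(law rate)) * ∫⁻ x, f x ∂(law rate) := by
  have h1 := hg.comp (measurable_timeToSuccess r s)
  have h2 := tendsto_lintegral_hitBefore rate s (h1.mul (hf.comp (measurable_afterSuccess s)))
  have h3 := ENNReal.Tendsto.mul_const (b := ∫⁻ x, f x ∂(law rate))
    (tendsto_lintegral_hitBefore rate s h1) (Or.inr hfin)
  refine tendsto_nhds_unique (h2.congr fun n => ?_) h3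
  exact lintegral_hitBefore rate r n s hg hf

end

section

variable (rate : Node → ℝ) [hrate : Fact (∀ s, 0 < rate s)]

lemma measurePreserving_afterSuccess (s : Status) :
    MeasurePreserving (afterSuccess s) (law rate) (law rate) := by
  refine ⟨measurable_afterSuccess s, Measure.ext fun A hA => ?_⟩
  rw [Measure.map_apply (measurable_afterSuccess s) hA]
  have h := lintegral_afterSuccess rate always s (g := fun _ => 1) measurable_const
    (f := A.indicator 1) (measurable_one.indicator hA)
    (by rw [lintegral_indicator_one hA]; exact measure_ne_top _ _)
  have h' : ∀ x, A.indicator (1 : Gaps → ℝ≥0∞) (afterSuccess s x) =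
      (afterSuccess s ⁻¹' A).indicator 1 x := fun _ => rfl
  simp only [one_mul, h'] at h
  rw [lintegral_indicator_one hA, lintegral_indicator_one (measurable_afterSuccess s hA)] at h
  simpa using h

lemma indepFun_timeToSuccess (r : Status → ℝ≥0∞) (s : Status) :
    IndepFun (timeToSuccess r s) (afterSuccess s) (law rate) := by
  rw [indepFun_iff_measure_inter_preimage_eq_mul]
  intro B A hB hA
  have hmB := measurable_timeToSuccess r s hB
  have hmA := measurable_afterSuccess s hA
  have h := lintegral_afterSuccess rate r s (g := B.indicator 1) (measurable_one.indicator hB)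
    (f := A.indicator 1) (measurable_one.indicator hA)
    (by rw [lintegral_indicator_one hA]; exact measure_ne_top _ _)
  have h' : ∀ x, B.indicator (1 : ℝ≥0∞ → ℝ≥0∞) (timeToSuccess r s x) *
      A.indicator (1 : Gaps → ℝ≥0∞) (afterSuccess s x) =
      (timeToSuccess r s ⁻¹' B ∩ afterSuccess s ⁻¹' A).indicator 1 x := fun x => by
    rw [Set.inter_indicator_one]
    rfl
  have h'' : ∀ x, B.indicator (1 : ℝ≥0∞ → ℝ≥0∞) (timeToSuccess r s x) =
      (timeToSuccess r s ⁻¹' B).indicator 1 x := fun _ => rfl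
  simp only [h'] at h
  simp only [h''] at h
  rw [lintegral_indicator_one (hmB.inter hmA), lintegral_indicator_one hmB,
    lintegral_indicator_one hA] at h
  rw [h, (measurePreserving_afterSuccess rate s).measure_preimage hA.nullMeasurableSet]

lemma measurePreserving_iterate_nextCycle (j : ℕ) :
    MeasurePreserving nextCycle^[j] (law rate) (law rate) :=
  (measurePreserving_afterSuccess rate Status.fresh).iterate j

lemma measurable_cycleTime (r : Status → ℝ≥0∞) : Measurable (cycleTime r) :=
  (measurable_timeToSuccess r _).ennreal_toReal

/-- By stationarity it suffices to compare the first cycle with a later one, which is a function of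
what follows the first cycle. -/
lemma indepFun_cycleTime (r : Status → ℝ≥0∞) {i j : ℕ} (hij : i < j) :
    IndepFun (fun x => cycleTime r (nextCycle^[i] x)) (fun x => cycleTime r (nextCycle^[j] x))
      (law rate) := by
  obtain ⟨k, rfl⟩ := Nat.exists_eq_add_of_lt hij
  have h0 : IndepFun (cycleTime r) (fun x => cycleTime r (nextCycle^[k] (nextCycle x)))
      (law rate) :=
    (indepFun_timeToSuccess rate r Status.fresh).comp ENNReal.measurable_toReal
      ((measurable_cycleTime r).comp (measurePreserving_iterate_nextCycle rate k).measurable)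
  have hmp := measurePreserving_iterate_nextCycle rate i
  have hcomp : (fun x => cycleTime r (nextCycle^[i + k + 1] x)) =
      (fun x => cycleTime r (nextCycle^[k] (nextCycle x))) ∘ nextCycle^[i] := by
    funext x
    rw [Function.comp_apply, ← Function.iterate_succ_apply, ← Function.iterate_add_apply]
    congr 2
    lia
  rw [hcomp]
  rw [indepFun_iff_measure_inter_preimage_eq_mul] at h0 ⊢
  intro B A hB hA
  have hm1 := measurable_cycleTime r hB
  have hm2 : MeasurableSet ((fun x => cycleTime r (nextCycle^[k] (nextCycle x))) ⁻¹' A) :=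
    ((measurable_cycleTime r).comp ((measurePreserving_iterate_nextCycle rate k).measurable.comp
      (measurable_afterSuccess Status.fresh))) hA
  have h := h0 B A hB hA
  rw [← hmp.measure_preimage (hm1.inter hm2).nullMeasurableSet,
    ← hmp.measure_preimage hm1.nullMeasurableSet,
    ← hmp.measure_preimage hm2.nullMeasurableSet] at h
  exact h

lemma integrable_cycleTime {r : Status → ℝ≥0∞} (hr : r ≤ always) :
    Integrable (cycleTime r) (law rate) :=
  integrable_toReal_of_lintegral_ne_top (measurable_timeToSuccess r _).aemeasurable
    (lintegral_timeToSuccess_ne_top rate hr _)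

lemma identDistrib_cycleTime (r : Status → ℝ≥0∞) (j : ℕ) :
    IdentDistrib (fun x => cycleTime r (nextCycle^[j] x)) (cycleTime r) (law rate) (law rate) := by
  have hmp := measurePreserving_iterate_nextCycle rate j
  refine ⟨((measurable_cycleTime r).comp hmp.measurable).aemeasurable,
    (measurable_cycleTime r).aemeasurable, ?_⟩
  conv_rhs => rw [← hmp.map_eq]
  rw [Measure.map_map (measurable_cycleTime r) hmp.measurable]
  rfl

/-- The strong law of large numbers for the cycles. -/
lemma ae_tendsto_sum_cycleTime {r : Status → ℝ≥0∞} (hr : r ≤ always) :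
    ∀ᵐ x ∂(law rate), Tendsto
      (fun n : ℕ => (∑ j ∈ Finset.range n, cycleTime r (nextCycle^[j] x)) / n) atTop
      (𝓝 (∫ x, cycleTime r x ∂(law rate))) :=
  strong_law_ae_real (fun j x => cycleTime r (nextCycle^[j] x)) (integrable_cycleTime rate hr)
    (fun i j hij => by
      rcases lt_or_gt_of_ne hij with h | h
      · exact indepFun_cycleTime rate r h
      · exact (indepFun_cycleTime rate r h).symm)
    (identDistrib_cycleTime rate r)

/-! ### Expectations of a cycle -/

/-- The expected time before the first successful update, weighted by the status (the conversion to
a real number is harmless for `r ≤ always`, when the expectation is finite). -/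
def expectedTime (r : Status → ℝ≥0∞) (s : Status) : ℝ :=
  (∫⁻ x, timeToSuccess r s x ∂(law rate)).toReal

/-- The expected time before the first of all events. -/
def expectedWait : ℝ := (∫⁻ x, ENNReal.ofReal (wait x) ∂(law rate)).toReal

lemma expectedWait_pos : 0 < expectedWait rate :=
  ENNReal.toReal_pos (lintegral_wait_ne_zero rate) (lintegral_wait_ne_top rate)

lemma integral_cycleTime {r : Status → ℝ≥0∞} (hr : r ≤ always) :
    ∫ x, cycleTime r x ∂(law rate) = expectedTime rate r Status.fresh :=
  integral_toReal (measurable_timeToSuccess r _).aemeasurable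
    (ae_lt_top (measurable_timeToSuccess r _) (lintegral_timeToSuccess_ne_top rate hr _))

lemma expectedTime_eq {r : Status → ℝ≥0∞} (hr : r ≤ always) (s : Status) :
    expectedTime rate r s = (r s).toReal * expectedWait rate +
      ∑ i, nodeProb rate i * if Succeeds s i then 0 else expectedTime rate r (s.step i) := by
  have hfin : ∀ i, (if Succeeds s i then 0 else
      ∫⁻ x, timeToSuccess r (s.step i) x ∂(law rate)) ≠ ∞ := fun i => by
    split_ifs
    · exact ENNReal.zero_ne_top
    · exact lintegral_timeToSuccess_ne_top rate hr _
  have hr' : r s ≠ ∞ := ((hr s).trans_lt ENNReal.one_lt_top).ne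
  have h := lintegral_reward rate r measurable_wait.ennreal_ofReal s
  change ∫⁻ x, timeToSuccess r s x ∂(law rate) = _ + ∑ i, ENNReal.ofReal (nodeProb rate i) *
    (if Succeeds s i then 0 else ∫⁻ x, timeToSuccess r (s.step i) x ∂(law rate)) at h
  rw [expectedTime, h, ENNReal.toReal_add (ENNReal.mul_ne_top hr' (lintegral_wait_ne_top rate))
    (ENNReal.sum_ne_top.2 fun i _ => ENNReal.mul_ne_top ENNReal.ofReal_ne_top (hfin i)),
    ENNReal.toReal_mul,
    ENNReal.toReal_sum fun i _ => ENNReal.mul_ne_top ENNReal.ofReal_ne_top (hfin i)]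
  congr 1
  refine Finset.sum_congr rfl fun i _ => ?_
  rw [ENNReal.toReal_mul, ENNReal.toReal_ofReal (nodeProb_pos rate i).le]
  split_ifs
  · simp
  · rfl

lemma expectedTime_always_fresh : expectedTime rate always Status.fresh = expectedWait rate *
    (1 / nodeProb rate Node.source + 1 / (nodeProb rate Node.cache * nodeProb rate Node.user)) := by
  have h1 := nodeProb_pos rate Node.source
  have h2 := nodeProb_pos rate Node.cache
  have h3 := nodeProb_pos rate Node.user
  have h := sum_nodeProb rate
  have e0 := expectedTime_eq rate (le_refl always) Status.stale
  have e1 := expectedTime_eq rate (le_refl always) Status.cached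
  have e2 := expectedTime_eq rate (le_refl always) Status.fresh
  rw [sum_node] at e0 e1 e2
  simp [Succeeds, Status.step, always] at e0 e1 e2
  generalize expectedTime rate _ Status.stale = l0 at *
  generalize expectedTime rate _ Status.cached = l1 at *
  generalize expectedTime rate _ Status.fresh = l2 at *
  generalize expectedWait rate = m at *
  generalize nodeProb rate Node.source = σ at *
  generalize nodeProb rate Node.cache = κ at *
  generalize nodeProb rate Node.user = υ at *
  obtain rfl : σ = 1 - κ - υ := by linarith
  -- `l0`, `l1`, `l2` are the expected times from the statuses `stale`, `cached`, `fresh`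
  have f0 : κ * (l0 - l1) = m := by linarith
  have f1 : κ * υ * l0 = m := by linear_combination κ * e1 + (1 - κ) * f0
  field_simp
  linear_combination κ * υ * e2 + (1 - κ - υ) * f1

lemma expectedTime_onlyFresh_fresh : expectedTime rate onlyFresh Status.fresh =
    expectedWait rate * (1 / nodeProb rate Node.source) := by
  have h1 := nodeProb_pos rate Node.source
  have h2 := nodeProb_pos rate Node.cache
  have h3 := nodeProb_pos rate Node.user
  have h := sum_nodeProb rate
  have e0 := expectedTime_eq rate onlyFresh_le_always Status.stale
  have e1 := expectedTime_eq rate onlyFresh_le_always Status.cached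
  have e2 := expectedTime_eq rate onlyFresh_le_always Status.fresh
  rw [sum_node] at e0 e1 e2
  simp [Succeeds, Status.step, onlyFresh] at e0 e1 e2
  generalize expectedTime rate _ Status.stale = l0 at *
  generalize expectedTime rate _ Status.cached = l1 at *
  generalize expectedTime rate _ Status.fresh = l2 at *
  generalize expectedWait rate = m at *
  generalize nodeProb rate Node.source = σ at *
  generalize nodeProb rate Node.cache = κ at *
  generalize nodeProb rate Node.user = υ at *
  obtain rfl : σ = 1 - κ - υ := by linarith
  -- `l0`, `l1`, `l2` are the expected fresh times from the statuses `stale`, `cached`, `fresh`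
  have f0 : κ * (l0 - l1) = 0 := by linarith
  have f1 : κ * υ * l0 = 0 := by linear_combination κ * e1 + (1 - κ) * f0
  have f2 : l0 = 0 := by simpa [h2.ne', h3.ne'] using f1
  field_simp
  linear_combination e2 + (1 - κ - υ) * f2

lemma expectedTime_always_pos : 0 < expectedTime rate always Status.fresh := by
  have h0 := expectedWait_pos rate
  have h1 := nodeProb_pos rate Node.source
  have h2 := nodeProb_pos rate Node.cache
  have h3 := nodeProb_pos rate Node.user
  rw [expectedTime_always_fresh]
  positivity

lemma expectedTime_div :
    expectedTime rate onlyFresh Status.fresh / expectedTime rate always Status.fresh =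
      rate Node.user / (rate Node.user + rate Node.source) *
        (rate Node.cache / (rate Node.cache + rate Node.source)) := by
  have h0 := expectedWait_pos rate
  have h1 := rate_pos rate Node.source
  have h2 := rate_pos rate Node.cache
  have h3 := rate_pos rate Node.user
  rw [expectedTime_always_fresh, expectedTime_onlyFresh_fresh, nodeProb, nodeProb, nodeProb,
    sum_node]
  field_simp
  ring

end

/-! ### Time averages -/

lemma tendsto_add_sum_div {d : ℕ → ℝ} {β : ℝ}
    (h : Tendsto (fun n : ℕ => (∑ j ∈ Finset.range n, d j) / n) atTop (𝓝 β)) (p : ℝ) :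
    Tendsto (fun n : ℕ => (p + ∑ j ∈ Finset.range n, d j) / n) atTop (𝓝 β) := by
  simpa [add_div] using (tendsto_const_div_atTop_nhds_zero_nat p).add h

/-- If an increasing function `A` grows at the rate `α` and time at the rate `β` along a sequence of
times, then `A T / T` tends to `α / β`. -/
lemma tendsto_div_of_subsequence {A : ℝ → ℝ} (hA : MonotoneOn A (Set.Ici 0)) (hA0 : 0 ≤ A 0)
    {S : ℕ → ℝ} (hS0 : ∀ n, 0 ≤ S n) (hS : Monotone S) {α β : ℝ} (hβ : 0 < β)
    (hSβ : Tendsto (fun n : ℕ => S n / n) atTop (𝓝 β))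
    (hAα : Tendsto (fun n : ℕ => A (S n) / n) atTop (𝓝 α)) :
    Tendsto (fun T => A T / T) atTop (𝓝 (α / β)) := by
  have hStop : Tendsto S atTop atTop := by
    have h := tendsto_natCast_atTop_atTop (R := ℝ).atTop_mul_pos hβ hSβ
    refine h.congr' ?_
    filter_upwards [eventually_gt_atTop 0] with n hn
    have : (n : ℝ) ≠ 0 := by positivity
    field_simp
  have hratio : Tendsto (fun n : ℕ => ((n + 1 : ℕ) : ℝ) / n) atTop (𝓝 1) := by
    have h := (tendsto_const_nhds (x := (1 : ℝ))).add
      (tendsto_const_div_atTop_nhds_zero_nat (1 : ℝ))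
    rw [add_zero] at h
    refine h.congr' ?_
    filter_upwards [eventually_gt_atTop 0] with n hn
    have : (n : ℝ) ≠ 0 := by positivity
    push_cast
    field_simp
  have hSβ' := hSβ.comp (tendsto_add_atTop_nat 1)
  have hAα' := hAα.comp (tendsto_add_atTop_nat 1)
  have hlow : Tendsto (fun n => A (S n) / S (n + 1)) atTop (𝓝 (α / β)) := by
    have h := hAα.div (hSβ'.mul hratio) (by simpa using hβ.ne')
    rw [mul_one] at h
    refine h.congr' ?_
    filter_upwards [eventually_gt_atTop 0, hStop.eventually_gt_atTop 0] with n hn hSn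
    have : (n : ℝ) ≠ 0 := by positivity
    have h' : 0 < S (n + 1) := hSn.trans_le (hS n.le_succ)
    simp only [Pi.div_apply, Function.comp_apply]
    field_simp
  have hup : Tendsto (fun n => A (S (n + 1)) / S n) atTop (𝓝 (α / β)) := by
    have h := (hAα'.mul hratio).div hSβ hβ.ne'
    rw [mul_one] at h
    refine h.congr' ?_
    filter_upwards [eventually_gt_atTop 0, hStop.eventually_gt_atTop 0] with n hn hSn
    have : (n : ℝ) ≠ 0 := by positivity
    simp only [Pi.div_apply, Function.comp_apply]
    field_simp
  have hex : ∀ T, ∃ n, T < S n := fun T => (hStop.eventually_gt_atTop T).exists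
  -- the number of the last time of the sequence which is at most `T`
  let N : ℝ → ℕ := fun T => Nat.find (hex T) - 1
  have hN : ∀ T, S 0 ≤ T → S (N T) ≤ T ∧ T < S (N T + 1) := by
    intro T hT
    have hpos : 0 < Nat.find (hex T) := (Nat.find_pos _).2 (not_lt.2 hT)
    refine ⟨not_lt.1 (Nat.find_min (hex T) (by simp only [N]; lia)), ?_⟩
    have := Nat.find_spec (hex T)
    rwa [show N T + 1 = Nat.find (hex T) by simp only [N]; lia]
  have hNtop : Tendsto N atTop atTop := by
    refine tendsto_atTop.2 fun k => ?_
    filter_upwards [eventually_ge_atTop (S k)] with T hT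
    have : k < Nat.find (hex T) := by
      rw [Nat.lt_find_iff]
      exact fun m hm => not_lt.2 ((hS hm).trans hT)
    simp only [N]
    lia
  refine tendsto_of_tendsto_of_tendsto_of_le_of_le' (hlow.comp hNtop) (hup.comp hNtop) ?_ ?_
  · filter_upwards [eventually_ge_atTop (S 0), eventually_gt_atTop 0] with T hT hT0
    obtain ⟨h1, h2⟩ := hN T hT
    have hA' : A (S (N T)) ≤ A T := hA (hS0 _) hT0.le h1
    have hAT : 0 ≤ A T := hA0.trans (hA Set.self_mem_Ici hT0.le hT0.le)
    exact div_le_div₀ hAT hA' hT0 h2.le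
  · filter_upwards [eventually_ge_atTop (S 0), eventually_gt_atTop 0,
      (hStop.comp hNtop).eventually_gt_atTop 0] with T hT hT0 hS'
    obtain ⟨h1, h2⟩ := hN T hT
    have hA' : A T ≤ A (S (N T + 1)) := hA hT0.le (hS0 _) h2.le
    have hAT : 0 ≤ A T := hA0.trans (hA Set.self_mem_Ici hT0.le hT0.le)
    exact div_le_div₀ (hAT.trans hA') hA' hS' h1

lemma successTime_eq_sum (x : Node → ℕ → ℝ) (a b : ℤ) (n : ℕ) :
    successTime x a b n = successTime x a b 0 + ∑ j ∈ Finset.range n, cycleLength x a b j := by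
  have := Finset.sum_range_sub (successTime x a b) n
  simp only [cycleLength, this]
  ring

lemma integral_freshness_eq_sum {x : Gaps} (hx : IsRegular x) (a b : ℤ) (n : ℕ) :
    ∫ t in (0 : ℝ)..(successTime (Function.curry x) a b n), freshness (Function.curry x) a b t =
      (∫ t in (0 : ℝ)..(successTime (Function.curry x) a b 0),
        freshness (Function.curry x) a b t) +
        ∑ j ∈ Finset.range n, freshDuration (Function.curry x) a b j := by
  induction n with
  | zero => simp
  | succ n ih =>
    rw [Finset.sum_range_succ, ← add_assoc, ← ih, freshDuration,
      intervalIntegral.integral_add_adjacent_intervals (intervalIntegrable_freshness hx _ _ _ _)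
        (intervalIntegrable_freshness hx _ _ _ _)]

lemma monotone_successTime {x : Gaps} (hx : IsGood x) {a b : ℤ} (hba : b ≤ a) (ha : a ≤ 0) :
    Monotone (successTime (Function.curry x) a b) :=
  monotone_nat_of_le_succ fun j => by
    have : 0 ≤ cycleLength (Function.curry x) a b j := by
      rw [cycleLength_eq hx hba ha]
      exact ENNReal.toReal_nonneg
    rw [cycleLength] at this
    linarith

lemma monotoneOn_integral_freshness {x : Gaps} (hx : IsRegular x) (a b : ℤ) :
    MonotoneOn (fun T => ∫ t in (0 : ℝ)..T, freshness (Function.curry x) a b t) (Set.Ici 0) :=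
  fun _ hp q _ hpq => intervalIntegral.integral_mono_interval le_rfl hp hpq
    (ae_of_all _ fun t => freshness_nonneg _ a b t) (intervalIntegrable_freshness hx a b 0 q)

lemma ae_tendsto_freshness (rate : Node → ℝ) [Fact (∀ s, 0 < rate s)] {a b : ℤ} (hba : b ≤ a)
    (ha : a ≤ 0) :
    ∀ᵐ x ∂(law rate), Tendsto
      (fun T : ℝ => (1 / T) * ∫ t in (0 : ℝ)..T, freshness (Function.curry x) a b t) atTop
      (𝓝 (rate Node.user / (rate Node.user + rate Node.source) *
        (rate Node.cache / (rate Node.cache + rate Node.source)))) := by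
  have hmp := (measurePreserving_afterSuccess rate (status (a, b))).quasiMeasurePreserving
  filter_upwards [ae_isGood rate, hmp.ae (ae_tendsto_sum_cycleTime rate le_rfl),
    hmp.ae (ae_tendsto_sum_cycleTime rate onlyFresh_le_always)] with x hx hL hD
  simp only [← cycleLength_eq hx hba ha] at hL
  simp only [← freshDuration_eq hx hba ha] at hD
  rw [integral_cycleTime rate le_rfl] at hL
  rw [integral_cycleTime rate onlyFresh_le_always] at hD
  have hL' := tendsto_add_sum_div hL (successTime (Function.curry x) a b 0)
  have hD' := tendsto_add_sum_div hD (∫ t in (0 : ℝ)..(successTime (Function.curry x) a b 0),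
    freshness (Function.curry x) a b t)
  simp only [← successTime_eq_sum] at hL'
  simp only [← integral_freshness_eq_sum hx.isRegular] at hD'
  have h := tendsto_div_of_subsequence (monotoneOn_integral_freshness hx.isRegular a b) (by simp)
    (successTime_nonneg hx a b) (monotone_successTime hx hba ha) (expectedTime_always_pos rate)
    hL' hD'
  rw [expectedTime_div] at h
  simpa only [one_div_mul_eq_div] using h

/-! ### Transfer to an arbitrary probability space -/

section

variable {Ω : Type*} [MeasurableSpace Ω] {μ : Measure Ω} {lam c u : ℝ} {X : Node → ℕ → Ω → ℝ}

lemma measurePreserving_gaps (hX : IsExponentialSystem μ lam c u X)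
    [Fact (∀ s, 0 < Node.rate lam c u s)] :
    MeasurePreserving (fun ω (p : Node × ℕ) => X p.1 p.2 ω) μ (law (Node.rate lam c u)) := by
  refine ⟨measurable_pi_lambda _ fun p => hX.measurable p.1 p.2, ?_⟩
  have := hX.indep.map_fun_eq_infinitePi_map fun p : Node × ℕ => hX.measurable p.1 p.2
  rw [this, law]
  simp only [hX.law]

lemma identDistrib_of_ae_eq_comp {rate : Node → ℝ} [Fact (∀ s, 0 < rate s)] {Φ : Ω → Gaps}
    (hΦ : MeasurePreserving Φ μ (law rate)) (s : Status) (r : Status → ℝ≥0∞) (j : ℕ) {f : Ω → ℝ}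
    (hf : f =ᵐ[μ] fun ω => cycleTime r (nextCycle^[j] (afterSuccess s (Φ ω)))) :
    IdentDistrib f (cycleTime r) μ (law rate) := by
  have hmp := ((measurePreserving_iterate_nextCycle rate j).comp
    (measurePreserving_afterSuccess rate s)).comp hΦ
  have hm := (measurable_cycleTime r).comp hmp.measurable
  refine ⟨hm.aemeasurable.congr hf.symm, (measurable_cycleTime r).aemeasurable, ?_⟩
  rw [Measure.map_congr hf, ← hmp.map_eq, Measure.map_map (measurable_cycleTime r) hmp.measurable]
  rfl

end

end CacheUpdating

end


open CacheUpdating in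
/-- A cached file. The source, the cache and the user have independent Poisson event streams with
rates `lam`, `c`, `u`; initially the source, the cache and the user hold versions `0`, `a`, `b`. -/
theorem theorem1 {Ω : Type*} [MeasurableSpace Ω] (μ : MeasureTheory.Measure Ω)
    [MeasureTheory.IsProbabilityMeasure μ] (lam c u : ℝ) (hlam : 0 < lam) (hc : 0 < c) (hu : 0 < u)
    (X : CacheUpdating.Node → ℕ → Ω → ℝ)
    (hX : CacheUpdating.IsExponentialSystem μ lam c u X)
    (a b : ℤ) (hba : b ≤ a) (ha : a ≤ 0) :
    -- almost surely, the long term average freshness exists and has the claimed value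
    (∀ᵐ ω ∂μ,
      (∀ T : ℝ, 0 ≤ T → IntervalIntegrable
        (CacheUpdating.freshness (fun s k => X s k ω) a b) MeasureTheory.volume 0 T) ∧
      Tendsto
        (fun T : ℝ => (1 / T) * ∫ t in (0 : ℝ)..T,
          CacheUpdating.freshness (fun s k => X s k ω) a b t)
        atTop (𝓝 (u / (u + lam) * (c / (c + lam))))) ∧
    -- almost surely, there are infinitely many update cycles
    (∀ᵐ ω ∂μ, {m : ℕ | CacheUpdating.IsSuccessful (fun s k => X s k ω) a b m}.Infinite) ∧
    -- the cycles have a common law of the length and of the fresh duration (so that one may speak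
    -- of typical ones), and the ratio of their expectations has the same value
    (∀ j : ℕ,
      IdentDistrib (fun ω => CacheUpdating.freshDuration (fun s k => X s k ω) a b j)
        (fun ω => CacheUpdating.freshDuration (fun s k => X s k ω) a b 0) μ μ ∧
      IdentDistrib (fun ω => CacheUpdating.cycleLength (fun s k => X s k ω) a b j)
        (fun ω => CacheUpdating.cycleLength (fun s k => X s k ω) a b 0) μ μ ∧
      Integrable (fun ω => CacheUpdating.freshDuration (fun s k => X s k ω) a b j) μ ∧
      Integrable (fun ω => CacheUpdating.cycleLength (fun s k => X s k ω) a b j) μ ∧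
      0 < (∫ ω, CacheUpdating.cycleLength (fun s k => X s k ω) a b j ∂μ) ∧
      (∫ ω, CacheUpdating.freshDuration (fun s k => X s k ω) a b j ∂μ) /
          (∫ ω, CacheUpdating.cycleLength (fun s k => X s k ω) a b j ∂μ) =
        u / (u + lam) * (c / (c + lam))) := by
  have : Fact (∀ s, 0 < Node.rate lam c u s) := ⟨fun s => by cases s <;> assumption⟩
  have hΦ := measurePreserving_gaps hX
  have hgood := hΦ.quasiMeasurePreserving.ae (ae_isGood (Node.rate lam c u))
  have hlen : ∀ j, IdentDistrib (fun ω => cycleLength (fun s k => X s k ω) a b j)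
      (cycleTime always) μ (law (Node.rate lam c u)) := fun j =>
    identDistrib_of_ae_eq_comp hΦ (status (a, b)) always j
      (hgood.mono fun ω hω => cycleLength_eq hω hba ha j)
  have hdur : ∀ j, IdentDistrib (fun ω => freshDuration (fun s k => X s k ω) a b j)
      (cycleTime onlyFresh) μ (law (Node.rate lam c u)) := fun j =>
    identDistrib_of_ae_eq_comp hΦ (status (a, b)) onlyFresh j
      (hgood.mono fun ω hω => freshDuration_eq hω hba ha j)
  refine ⟨?_, hgood.mono fun ω hω => infinite_isSuccessful hω hba ha, fun j => ⟨?_, ?_, ?_, ?_, ?_⟩⟩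
  · filter_upwards [hgood,
      hΦ.quasiMeasurePreserving.ae (ae_tendsto_freshness (Node.rate lam c u) hba ha)] with ω h1 h2
    exact ⟨fun T _ => intervalIntegrable_freshness h1.isRegular a b 0 T, h2⟩
  · exact (hdur j).trans (hdur 0).symm
  · exact (hlen j).trans (hlen 0).symm
  · exact (hdur j).integrable_iff.2 (integrable_cycleTime _ onlyFresh_le_always)
  · exact (hlen j).integrable_iff.2 (integrable_cycleTime _ le_rfl)
  · rw [(hlen j).integral_eq, (hdur j).integral_eq, integral_cycleTime _ le_rfl,
      integral_cycleTime _ onlyFresh_le_always]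
    exact ⟨expectedTime_always_pos _, expectedTime_div _⟩
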